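/- For every $\gamma_0\in\mathbb{R}$ there is a constant $C>0$, depending only on $\gamma_0$, such that the following holds. Let $\Omega\subset\mathbb{R}^2$ be a set whose closure is triangulated (for instance a bounded polygonal domain), and let $\mathcal{T}_H,\mathcal{T}_h$ be two conforming triangulations of $\overline\Omega$ (finitely many nondegenerate closed triangles covering $\overline\Omega$, any two distinct ones of which meet in the empty set, a common vertex or a common edge) such that $\mathcal{T}_h$ is a refinement of $\mathcal{T}_H$ (every triangle of $\mathcal{T}_h$ is contained in one of $\mathcal{T}_H$) and $r_K/\rho_K<\gamma_0$ for all $K\in\mathcal{T}_H\cup\mathcal{T}_h$, where $r_K$ and $\rho_K$ are the radii of the circumscribed and the inscribed circle of $K$. Let $T\in\mathcal{T}_H$, let $\mathcal{T}_h(T)$ be the set of all $T'\in\mathcal{T}_h$ with $T'\subset T$, and let $\mathcal{E}_h(\mathring{T})$ be the set of all edges $e$ of $\mathcal{T}_h$ with $e\subset T$ and $e\not\subseteq\partial T$. Let $r\ge 0$ be an integer and let $v_h\in L^2(T,\mathbb{R}^2)$ be such that $v_h|_{T'}$ is a vector field with polynomial components of degree at most $r+2$ for every $T'\in\mathcal{T}_h(T)$.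 Then $$h_T^{-2}\,\|v_h-Q_Tv_h\|_T^2\le C\Big(\sum_{T'\in\mathcal{T}_h(T)}\|\varepsilon(v_h)\|_{T'}^2+\sum_{e\in\mathcal{E}_h(\mathring{T})}h_e^{-1}\,\|[v_h]\|_e^2\Big).$$ Here $\|\cdot\|_K$ and $\|\cdot\|_e$ are the $L^2$ norms on a triangle $K$ and on an edge $e$ (with respect to arc length), with the Euclidean norm for vectors and the Frobenius norm for matrices; $h_T=|T|^{1/2}$ with $|T|$ the area of $T$; $h_e$ is the length of $e$; $Q_T$ is the $L^2(T)$-orthogonal projection onto the space of rigid body motions $\{(c_1,c_2)^\top+c_3(-x_2,x_1)^\top: c_1,c_2,c_3\in\mathbb{R}\}$; $\varepsilon(v)=\frac12(\nabla v+(\nabla v)^\top)$ is taken on each triangle $T'$ separately; and $[v_h]=v_h|_{T_+}-v_h|_{T_-}$ on $e$ is the jump between the traces from the two triangles $T_+,T_-\in\mathcal{T}_h$ that share $e$ (its sign is immaterial). -/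

import Mathlib

open MeasureTheory Set
open scoped Classical

noncomputable section

namespace DiscreteKorn

/-- The Euclidean plane. -/
abbrev Plane : Type := EuclideanSpace ℝ (Fin 2)

/-- The closed triangle (or edge) spanned by a finite set of vertices. -/
def hull (s : Finset Plane) : Set Plane := convexHull ℝ (s : Set Plane)

/-! ### Conforming triangulations -/

/-- A conforming triangulation of (the closure of) a planar set `Ω`: finitely many nondegenerate
triangles, each given by its set of three vertices, which cover `closure Ω`, such that any two of
them meet exactly in the simplex spanned by their common vertices (nothing, a common vertex, a
common edge, or, if they are equal, the whole triangle). -/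
structure Triangulation (Ω : Set Plane) where
  triangles : Finset (Finset Plane)
  card_eq : ∀ t ∈ triangles, t.card = 3
  indep : ∀ t ∈ triangles, AffineIndependent ℝ (fun x : t => (x : Plane))
  conforming : ∀ s ∈ triangles, ∀ t ∈ triangles, hull s ∩ hull t = hull (s ∩ t)
  covers : (⋃ t ∈ triangles, hull t) = closure Ω

namespace Triangulation

variable {Ω : Set Plane}

/-- A triangle of the triangulation as a Mathlib simplex (with some numbering of its vertices). -/
def toSimplex (𝒯 : Triangulation Ω) (t : Finset Plane) (ht : t ∈ 𝒯.triangles) :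
    Affine.Simplex ℝ Plane 2 where
  points i := ((t.equivFinOfCardEq (𝒯.card_eq t ht)).symm i : Plane)
  independent := (𝒯.indep t ht).comp_embedding
    (t.equivFinOfCardEq (𝒯.card_eq t ht)).symm.toEmbedding

/-- Shape regularity with constant `γ₀`: circumradius over inradius is `< γ₀` on every triangle. -/
def ShapeRegular (𝒯 : Triangulation Ω) (γ₀ : ℝ) : Prop :=
  ∀ (t : Finset Plane) (ht : t ∈ 𝒯.triangles),
    (𝒯.toSimplex t ht).circumradius / (𝒯.toSimplex t ht).inradius < γ₀

/-- `𝒯h` is a refinement of `𝒯H` (two triangulations of the same `Ω`): every triangle of `𝒯h` is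
contained in a triangle of `𝒯H`. -/
def IsRefinement (𝒯H 𝒯h : Triangulation Ω) : Prop :=
  ∀ t' ∈ 𝒯h.triangles, ∃ t ∈ 𝒯H.triangles, hull t' ⊆ hull t

/-- The triangles of `𝒯` contained in the triangle `t`. -/
def trianglesIn (𝒯 : Triangulation Ω) (t : Finset Plane) : Finset (Finset Plane) :=
  𝒯.triangles.filter fun t' => hull t' ⊆ hull t

/-- All edges of the triangulation, each given by its two endpoints. -/
def edges (𝒯 : Triangulation Ω) : Finset (Finset Plane) :=
  𝒯.triangles.biUnion fun t => t.powersetCard 2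

/-- The edges of `𝒯` contained in the triangle `t` but not in its boundary. -/
def interiorEdgesIn (𝒯 : Triangulation Ω) (t : Finset Plane) : Finset (Finset Plane) :=
  𝒯.edges.filter fun e => hull e ⊆ hull t ∧ ¬ hull e ⊆ frontier (hull t)

end Triangulation

/-- The size `h_T = |T|^{1/2}` of a triangle. -/
def size (t : Finset Plane) : ℝ := Real.sqrt (volume.real (hull t))

/-- The diameter (length) `h_e` of an edge. -/
def edgeLength (e : Finset Plane) : ℝ := Metric.diam (hull e)

/-! ### Rigid body motions and the projection onto them -/

/-- The rigid body motions `(c₁, c₂) + c₃ (-x₂, x₁)`. -/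
def rigidMotions : Submodule ℝ (Plane → Plane) where
  carrier := {m | ∃ c₁ c₂ c₃ : ℝ, ∀ x : Plane, m x = !₂[c₁ - c₃ * x 1, c₂ + c₃ * x 0]}
  zero_mem' := ⟨0, 0, 0, fun x => by ext i; fin_cases i <;> simp⟩
  add_mem' := by
    rintro m n ⟨a, b, c, hm⟩ ⟨a', b', c', hn⟩
    refine ⟨a + a', b + b', c + c', fun x => ?_⟩
    ext i; fin_cases i <;> simp [hm, hn] <;> ring
  smul_mem' := by
    rintro k m ⟨a, b, c, hm⟩
    refine ⟨k * a, k * b, k * c, fun x => ?_⟩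
    ext i; fin_cases i <;> simp [hm] <;> ring

/-- `L²(T, ℝ²)`. -/
abbrev L2 (T : Set Plane) : Type := Lp Plane 2 (volume.restrict T)

/-- The rigid body motions as a subspace of `L²(T, ℝ²)`. -/
def rigidMotionsL2 (T : Set Plane) : Submodule ℝ (L2 T) where
  carrier := {f | ∃ m ∈ rigidMotions, f =ᵐ[volume.restrict T] m}
  zero_mem' := ⟨0, rigidMotions.zero_mem, Lp.coeFn_zero _ _ _⟩
  add_mem' := by
    rintro f g ⟨m, hm, hfm⟩ ⟨n, hn, hgn⟩
    exact ⟨m + n, rigidMotions.add_mem hm hn, (Lp.coeFn_add f g).trans (hfm.add hgn)⟩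
  smul_mem' := by
    rintro k f ⟨m, hm, hfm⟩
    exact ⟨k • m, rigidMotions.smul_mem k hm, (Lp.coeFn_smul k f).trans (hfm.const_smul k)⟩

instance : FiniteDimensional ℝ rigidMotions := by
  let L : (ℝ × ℝ × ℝ) →ₗ[ℝ] (Plane → Plane) :=
    { toFun := fun c x => !₂[c.1 - c.2.2 * x 1, c.2.1 + c.2.2 * x 0]
      map_add' := by
        intro a b; ext x i; fin_cases i <;> simp <;> ring
      map_smul' := by
        intro a b; ext x i; fin_cases i <;> simp <;> ring }
  have h : rigidMotions ≤ LinearMap.range L := by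
    rintro m ⟨a, b, c, hm⟩
    exact ⟨(a, b, c), funext fun x => (hm x).symm⟩
  exact Submodule.finiteDimensional_of_le h

instance (T : Set Plane) : FiniteDimensional ℝ (rigidMotionsL2 T) := by
  let S : Submodule ℝ rigidMotions :=
    { carrier := {m | MemLp (m : Plane → Plane) 2 (volume.restrict T)}
      zero_mem' := MemLp.zero
      add_mem' := fun ha hb => MemLp.add ha hb
      smul_mem' := fun k _ ha => MemLp.const_smul ha k }
  let L : S →ₗ[ℝ] L2 T :=
    { toFun := fun m => MemLp.toLp _ m.2
      map_add' := fun _ _ => rfl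
      map_smul' := fun _ _ => rfl }
  have h : rigidMotionsL2 T ≤ LinearMap.range L := by
    rintro f ⟨m, hm, hfm⟩
    have hmem : MemLp m 2 (volume.restrict T) := (memLp_congr_ae hfm).1 (Lp.memLp f)
    refine ⟨⟨⟨m, hm⟩, hmem⟩, ?_⟩
    exact Lp.ext ((MemLp.coeFn_toLp hmem).trans hfm.symm)
  exact Submodule.finiteDimensional_of_le h

/-- The `L²(T)`-orthogonal projection `Q_T` onto the rigid body motions. -/
def rigidProj (T : Set Plane) : L2 T →L[ℝ] L2 T := (rigidMotionsL2 T).starProjection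

/-! ### Piecewise polynomial vector fields -/

/-- The vector field on the plane given by a pair of polynomials in two variables. -/
def polyField (p : Fin 2 → MvPolynomial (Fin 2) ℝ) (x : Plane) : Plane :=
  !₂[(p 0).eval (fun j => x j), (p 1).eval (fun j => x j)]

/-- `v` coincides (almost everywhere) on the triangle `t` with the polynomial field `p`. -/
def AgreesOn (v : Plane → Plane) (t : Finset Plane) (p : Fin 2 → MvPolynomial (Fin 2) ℝ) : Prop :=
  v =ᵐ[volume.restrict (hull t)] polyField p

/-- The space `U_h|_T`: vector fields in `L²(T, ℝ²)` that are polynomial of degree at most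
`r + 2` on each triangle of `𝒯` contained in the triangle `t`. -/
def brokenPoly {Ω : Set Plane} (𝒯 : Triangulation Ω) (r : ℕ) (t : Finset Plane) :
    Set (L2 (hull t)) :=
  {v | ∀ t' ∈ 𝒯.trianglesIn t, ∃ p : Fin 2 → MvPolynomial (Fin 2) ℝ,
    (∀ i, (p i).totalDegree ≤ r + 2) ∧ AgreesOn v t' p}

/-- The restriction `v|_{T'}` of a piecewise polynomial field to a triangle, as the (unique)
polynomial field that agrees with it there; it also provides the traces on the edges.
(The value is `0` if `v` is not polynomial on the triangle.) -/
def piece (v : Plane → Plane) (t' : Finset Plane) : Plane → Plane :=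
  if h : ∃ p, AgreesOn v t' p then polyField h.choose else 0

/-- The symmetric gradient `ε(w) = (∇w + (∇w)ᵀ) / 2` at a point, `(∇w)ᵢⱼ = ∂ⱼ wᵢ`. -/
def symGrad (w : Plane → Plane) (x : Plane) : Matrix (Fin 2) (Fin 2) ℝ := fun i j =>
  (fderiv ℝ w x (EuclideanSpace.single j 1) i + fderiv ℝ w x (EuclideanSpace.single i 1) j) / 2

/-- `‖ε(v)‖²_{T'}`, the squared `L²(T')` norm of the symmetric gradient on a triangle `T'`. -/
def strainSq (v : Plane → Plane) (t' : Finset Plane) : ℝ :=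
  ∫ x in hull t', ∑ i, ∑ j, symGrad (piece v t') x i j ^ 2

/-- The jump `[v] = v|_{T₊} - v|_{T₋}` over an edge `e` shared by two different triangles `T₊`, `T₋`
of `𝒯`. Which of the two is called `T₊` is an arbitrary choice that only affects the sign.
(Other edges do not occur below; the value there is `0`.) -/
def jump {Ω : Set Plane} (𝒯 : Triangulation Ω) (v : Plane → Plane) (e : Finset Plane) :
    Plane → Plane :=
  if h : ∃ T : Finset Plane × Finset Plane, T.1 ∈ 𝒯.triangles ∧ T.2 ∈ 𝒯.triangles ∧
      T.1 ≠ T.2 ∧ e ⊆ T.1 ∧ e ⊆ T.2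
  then piece v h.choose.1 - piece v h.choose.2 else 0

/-- `‖[v]‖²_e`, the squared `L²(e)` norm of the jump with respect to arc length on `e`. -/
def jumpSq {Ω : Set Plane} (𝒯 : Triangulation Ω) (v : Plane → Plane) (e : Finset Plane) : ℝ :=
  ∫ x in hull e, ‖jump 𝒯 v e x‖ ^ 2 ∂(Measure.hausdorffMeasure 1)

end DiscreteKorn

end

/-!
The estimate is the planar Korn-Poincaré inequality in the space of functions of bounded
deformation, `‖v - m‖_{L²(T)} ≤ C |Ev|(T)` for a suitable rigid motion `m`, followed by the
Cauchy-Schwarz inequality. For a broken polynomial field the deformation measure `Ev` has total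
mass at most `∑ ∫ |ε(v)| + ∑ ∫ |[v]|` (`totalStrain`), and by the shape regularity
`∑ h_e² ≤ C |T|` (`sum_edgeLength_sq_le`) the square of this mass is at most `C |T|` times the
right-hand side (`totalStrain_sq_le`). As no inverse or trace inequality for polynomials enters, the constant does
not depend on the degree.

The inequality itself comes from one-dimensional arguments along the lines parallel to the three
edges of `T`. On such a line with direction `η` the component `⟨v, η⟩` is piecewise smooth, its
derivative is `⟨ε(v) η, η⟩`, and it jumps where the line crosses an edge of the fine
triangulation. So it oscillates on the line by at most a function of the line whose integral is
controlled by the total strain (`exists_line_oscillation`, from `piecewise_variation` and Fubini's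
theorem).

In the affine coordinates of `T`, where `T` becomes the unit simplex, write `u` and `w` for the
components of `v` along two edges, so that `u - w` is the component along the third. Up to these
oscillations `u` is a function of `y`, `w` is a function of `x`, and `u - w` is a function of
`x + y`: the three functions of one variable satisfy Pexider's equation up to an error in `L¹`.
Hence they are affine with related slopes up to an error in `L¹` (`pexider_stability`), which says that
`v` is a rigid motion up to errors that depend on one of `x`, `y`, `x + y` only. Products of
errors that depend on different ones of these variables are integrable, with the product of the
`L¹` norms as a bound, and `u² = u w + u (u - w)`, `w² = u w - w (u - w)` are sums of such
products (`korn_of_line_oscillation`).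
-/

noncomputable section

namespace DiscreteKorn

/-! ### Averages of functions of one variable -/

lemma intervalIntegrable_of_bdd {f : ℝ → ℝ} (hf : Measurable f) {M : ℝ} (hM : ∀ x, |f x| ≤ M)
    (a b : ℝ) : IntervalIntegrable f volume a b := by
  rw [intervalIntegrable_iff]
  exact Measure.integrableOn_of_bounded (M := M) (by simp) hf.aestronglyMeasurable
    (Filter.Eventually.of_forall fun x => by simpa using hM x)

lemma enorm_intervalIntegral_le {f : ℝ → ℝ} {g : ℝ → ENNReal} {a b : ℝ} (hab : a ≤ b)
    (h : ∀ x ∈ Ioc a b, ‖f x‖ₑ ≤ g x) : ‖∫ x in a..b, f x‖ₑ ≤ ∫⁻ x in Ioc a b, g x := by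
  rw [intervalIntegral.integral_of_le hab]
  exact (enorm_integral_le_lintegral_enorm _).trans (setLIntegral_mono' measurableSet_Ioc h)

lemma setLIntegral_Ioc_shift_le (E : ℝ → ENNReal) (a b c : ℝ) :
    ∫⁻ x in Ioc a b, E (c + x) ≤ ∫⁻ x, E x :=
  (setLIntegral_le_lintegral _ _).trans (lintegral_add_left_eq_self E c).le

/-- The integral of `h` over the tent-shaped kernel `1_{[0,1/4]} * 1_{[0,1/4]}` shifted to `x`. -/
def tentAverage (h : ℝ → ℝ) (x : ℝ) : ℝ :=
  ∫ z in (0 : ℝ)..(1 / 4), ∫ w in (0 : ℝ)..(1 / 4), h (x + z + w)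

lemma hasDerivAt_tentAverage {h : ℝ → ℝ} (hh : Measurable h) {M : ℝ} (hM : ∀ x, |h x| ≤ M)
    (x : ℝ) : HasDerivAt (tentAverage h)
      (∫ w in (0 : ℝ)..(1 / 4), (h (x + 1 / 4 + w) - h (x + w))) x := by
  set H : ℝ → ℝ := fun x => ∫ t in (0 : ℝ)..x, h t with hH
  have hint := intervalIntegrable_of_bdd hh hM
  have hHc : Continuous H := intervalIntegral.continuous_primitive hint 0
  have hsub : ∀ a, ∫ w in (0 : ℝ)..(1 / 4), h (a + w) = H (a + 1 / 4) - H a := by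
    intro a
    rw [intervalIntegral.integral_comp_add_left (fun t => h t) a, add_zero,
      intervalIntegral.integral_interval_sub_left (hint _ _) (hint _ _)]
  have h1 : tentAverage h = fun x => (∫ t in x..(x + 1 / 4), (H (t + 1 / 4) - H t)) := by
    funext x
    simp only [tentAverage, hsub]
    rw [intervalIntegral.integral_comp_add_left (fun t => H (t + 1 / 4) - H t) x, add_zero]
  set G : ℝ → ℝ := fun t => H (t + 1 / 4) - H t with hG
  have hGc : Continuous G := by fun_prop
  have h2 : tentAverage h = fun x =>
      (∫ t in (0 : ℝ)..(x + 1 / 4), G t) - ∫ t in (0 : ℝ)..x, G t := by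
    rw [h1]; funext x
    rw [intervalIntegral.integral_interval_sub_left (hGc.intervalIntegrable _ _)
      (hGc.intervalIntegrable _ _)]
  have hd : ∀ x, HasDerivAt (fun u => ∫ t in (0 : ℝ)..u, G t) (G x) x := fun x =>
    intervalIntegral.integral_hasDerivAt_right (hGc.intervalIntegrable _ _)
      hGc.stronglyMeasurable.stronglyMeasurableAtFilter hGc.continuousAt
  have h3 : ∫ w in (0 : ℝ)..(1 / 4), (h (x + 1 / 4 + w) - h (x + w)) = G (x + 1 / 4) - G x := by
    have hc : ∀ a, IntervalIntegrable (fun w => h (a + w)) volume 0 (1 / 4) := fun a =>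
      intervalIntegrable_of_bdd (hh.comp (measurable_const_add a)) (fun x => hM _) _ _
    rw [intervalIntegral.integral_sub (hc _) (hc _), hsub, hsub]
  rw [h2, h3]
  exact ((hd (x + 1 / 4)).comp_add_const x (1 / 4)).sub (hd x)

/-- The error `∫ E₁ + ∫ E₂ + ∫ E₃` controls the deviation of the tent average of `h` from an
affine function: its derivative is an average of increments of `h`, and these are nearly increments
of `f₂` that do not depend on `x`. -/
lemma tentAverage_near_affine {f₁ f₂ h : ℝ → ℝ} (hf₂ : Measurable f₂)
    (hh : Measurable h) {M : ℝ} (hM₂ : ∀ x, |f₂ x| ≤ M)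
    (hM : ∀ x, |h x| ≤ M) {E₁ E₂ E₃ : ℝ → ENNReal} (hE₁ : Measurable E₁) (hE₂ : Measurable E₂)
    (hE₃ : Measurable E₃)
    (H : ∀ x y, 0 < x → 0 < y → x + y < 1 → ‖f₁ x + f₂ y - h (x + y)‖ₑ ≤ E₁ x + E₂ y + E₃ (x + y)) :
    ∃ α κ : ℝ, ∀ x ∈ Ioo (0 : ℝ) (1 / 2), ‖tentAverage h x - (α + κ * x)‖ₑ ≤
      2 * ((∫⁻ x, E₁ x) + (∫⁻ x, E₂ x) + ∫⁻ x, E₃ x) := by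
  set κ : ℝ := ∫ w in (0 : ℝ)..(1 / 4), (f₂ (1 / 4 + w) - f₂ w) with hκ
  set D : ℝ → ℝ := fun x => ∫ w in (0 : ℝ)..(1 / 4), (h (x + 1 / 4 + w) - h (x + w)) with hD
  have hc : ∀ {g : ℝ → ℝ} (_ : Measurable g) (_ : ∀ x, |g x| ≤ M) (a : ℝ),
      IntervalIntegrable (fun w => g (a + w)) volume 0 (1 / 4) := fun hg hM a =>
    intervalIntegrable_of_bdd (hg.comp (measurable_const_add a)) (fun x => hM _) _ _
  have herr : ∀ x ∈ Ioo (0 : ℝ) (1 / 2),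
      ‖D x - κ‖ₑ ≤ 2 * (E₁ x + (∫⁻ x, E₂ x) + ∫⁻ x, E₃ x) := by
    intro x hx
    have e1 : D x - κ = ∫ w in (0 : ℝ)..(1 / 4),
        ((f₁ x + f₂ w - h (x + w)) - (f₁ x + f₂ (1 / 4 + w) - h (x + (1 / 4 + w)))) := by
      rw [hD, hκ]
      dsimp only
      rw [← intervalIntegral.integral_sub]
      · refine intervalIntegral.integral_congr fun w _ => ?_
        rw [add_assoc x]; ring
      · exact (hc hh hM _).sub (hc hh hM _)
      · have := hc hf₂ hM₂ 0
        simp only [zero_add] at this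
        exact (hc hf₂ hM₂ _).sub this
    rw [e1]
    refine (enorm_intervalIntegral_le (by norm_num) (g := (fun w =>
      E₁ x + E₂ (0 + w) + E₃ (x + w)) + fun w =>
        E₁ x + E₂ (1 / 4 + w) + E₃ (x + 1 / 4 + w)) ?_).trans ?_
    · intro w hw
      have := hx.1; have := hx.2; have := hw.1; have := hw.2
      refine enorm_sub_le.trans (add_le_add ?_ ?_)
      · simpa using H x w (by linarith) (by linarith) (by linarith)
      · have := H x (1 / 4 + w) (by linarith) (by linarith) (by linarith)
        rwa [← add_assoc x] at this ⊢
    · have m1 : ∀ {E : ℝ → ENNReal} (_ : Measurable E) (c : ℝ), Measurable fun w => E (c + w) :=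
        fun hE c => hE.comp (measurable_const_add c)
      have key : ∀ c d : ℝ, ∫⁻ w in Ioc (0 : ℝ) (1 / 4), (E₁ x + E₂ (c + w) + E₃ (d + w)) ≤
          E₁ x + (∫⁻ x, E₂ x) + ∫⁻ x, E₃ x := by
        intro c d
        rw [lintegral_add_right _ (m1 hE₃ d), lintegral_add_right _ (m1 hE₂ c)]
        refine add_le_add (add_le_add ?_ (setLIntegral_Ioc_shift_le _ _ _ _))
          (setLIntegral_Ioc_shift_le _ _ _ _)
        rw [setLIntegral_const]
        refine mul_le_of_le_one_right' ?_
        rw [Real.volume_Ioc]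
        exact ENNReal.ofReal_le_one.2 (by norm_num)
      simp only [Pi.add_apply]
      rw [lintegral_add_left (by fun_prop), two_mul]
      exact add_le_add (key _ _) (key _ _)
  refine ⟨tentAverage h (1 / 4) - κ / 4, κ, fun x hx => ?_⟩
  have hDc : Continuous D := by
    have h1 : D = fun x => (∫ t in (0:ℝ)..(x + 1 / 2), h t) - 2 * (∫ t in (0:ℝ)..(x + 1 / 4), h t) +
        ∫ t in (0:ℝ)..x, h t := by
      funext x
      have hint := intervalIntegrable_of_bdd hh hM
      rw [hD]; dsimp only
      rw [intervalIntegral.integral_sub (hc hh hM _) (hc hh hM _),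
        intervalIntegral.integral_comp_add_left (fun t => h t),
        intervalIntegral.integral_comp_add_left (fun t => h t),
        add_zero, add_zero, show x + 1 / 4 + 1 / 4 = x + 1 / 2 by ring,
        ← intervalIntegral.integral_interval_sub_left (hint 0 (x + 1 / 2)) (hint 0 _),
        ← intervalIntegral.integral_interval_sub_left (hint 0 (x + 1 / 4)) (hint 0 x)]
      ring
    have hHc := intervalIntegral.continuous_primitive (intervalIntegrable_of_bdd hh hM) 0
    rw [h1]; fun_prop
  have e2 : tentAverage h x - (tentAverage h (1 / 4) - κ / 4 + κ * x) =
      ∫ t in (1 / 4 : ℝ)..x, (D t - κ) := by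
    rw [intervalIntegral.integral_sub (hDc.intervalIntegrable _ _) (by simp),
      intervalIntegral.integral_eq_sub_of_hasDerivAt
        (fun t _ => hasDerivAt_tentAverage hh hM t) (hDc.intervalIntegrable _ _)]
    simp; ring
  have e3 : ‖∫ t in (1 / 4 : ℝ)..x, (D t - κ)‖ₑ ≤
      ∫⁻ t in Ioo (0 : ℝ) (1 / 2), ‖D t - κ‖ₑ := by
    rw [← enorm_norm, intervalIntegral.norm_intervalIntegral_eq, enorm_norm]
    refine (enorm_integral_le_lintegral_enorm _).trans (lintegral_mono_set ?_)
    intro t ht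
    rw [uIoc, mem_Ioc, min_lt_iff, le_max_iff] at ht
    have := hx.1; have := hx.2
    constructor
    · rcases ht.1 with h | h <;> linarith
    · rcases ht.2 with h | h <;> linarith
  rw [e2]
  refine e3.trans ((setLIntegral_mono' measurableSet_Ioo herr).trans ?_)
  rw [lintegral_const_mul _ (by fun_prop), lintegral_add_right _ (by fun_prop),
    lintegral_add_right _ (by fun_prop)]
  refine mul_le_mul_right ?_ _
  have hone : volume (Ioo (0 : ℝ) (1 / 2)) ≤ 1 := by
    rw [Real.volume_Ioo]; exact ENNReal.ofReal_le_one.2 (by norm_num)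
  refine add_le_add (add_le_add (setLIntegral_le_lintegral _ _) ?_) ?_
  all_goals rw [setLIntegral_const]; exact mul_le_of_le_one_right' hone

/-- Averaging `f₁ x + f₂ y ≈ h (x + y)` over `y` with the tent kernel, which has mass `1 / 16`. -/
lemma tentAverage_near_left {f₁ f₂ h : ℝ → ℝ} (hf₂ : Measurable f₂)
    (hh : Measurable h) {M : ℝ} (hM₂ : ∀ x, |f₂ x| ≤ M)
    (hM : ∀ x, |h x| ≤ M) {E₁ E₂ E₃ : ℝ → ENNReal} (hE₂ : Measurable E₂)
    (hE₃ : Measurable E₃)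
    (H : ∀ x y, 0 < x → 0 < y → x + y < 1 → ‖f₁ x + f₂ y - h (x + y)‖ₑ ≤ E₁ x + E₂ y + E₃ (x + y))
    {x : ℝ} (hx : x ∈ Ioo (0 : ℝ) (1 / 2)) :
    ‖f₁ x / 16 + tentAverage f₂ 0 - tentAverage h x‖ₑ ≤
      E₁ x + (∫⁻ x, E₂ x) + ∫⁻ x, E₃ x := by
  have hc : ∀ {g : ℝ → ℝ} (_ : Measurable g) (_ : ∀ x, |g x| ≤ M) (a : ℝ),
      IntervalIntegrable (fun w => g (a + w)) volume 0 (1 / 4) := fun hg hM a =>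
    intervalIntegrable_of_bdd (hg.comp (measurable_const_add a)) (fun x => hM _) _ _
  have hc2 : ∀ {g : ℝ → ℝ} (_ : Measurable g) (_ : ∀ x, |g x| ≤ M) (a : ℝ),
      IntervalIntegrable (fun z => ∫ w in (0 : ℝ)..(1 / 4), g (a + z + w)) volume 0 (1 / 4) := by
    intro g hg hM a
    refine Continuous.intervalIntegrable ?_ _ _
    have hHc := intervalIntegral.continuous_primitive (intervalIntegrable_of_bdd hg hM) 0
    have hint := intervalIntegrable_of_bdd hg hM
    have : (fun z => ∫ w in (0 : ℝ)..(1 / 4), g (a + z + w)) = fun z =>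
        (∫ t in (0 : ℝ)..(a + z + 1 / 4), g t) - ∫ t in (0 : ℝ)..(a + z), g t := by
      funext z
      rw [intervalIntegral.integral_comp_add_left (fun t => g t),
        ← intervalIntegral.integral_interval_sub_left (hint 0 _) (hint 0 _), add_zero]
    rw [this]; fun_prop
  have e1 : f₁ x / 16 + tentAverage f₂ 0 - tentAverage h x = ∫ z in (0 : ℝ)..(1 / 4),
      ∫ w in (0 : ℝ)..(1 / 4), (f₁ x + f₂ (0 + z + w) - h (x + z + w)) := by
    have inner : ∀ z, ∫ w in (0 : ℝ)..(1 / 4), (f₁ x + f₂ (0 + z + w) - h (x + z + w)) =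
        f₁ x / 4 + (∫ w in (0 : ℝ)..(1 / 4), f₂ (0 + z + w)) -
          ∫ w in (0 : ℝ)..(1 / 4), h (x + z + w) := by
      intro z
      rw [intervalIntegral.integral_sub (IntervalIntegrable.add (by simp) (hc hf₂ hM₂ _))
        (hc hh hM _), intervalIntegral.integral_add (by simp) (hc hf₂ hM₂ _)]
      simp; ring
    simp only [inner]
    rw [intervalIntegral.integral_sub (IntervalIntegrable.add (by simp) (hc2 hf₂ hM₂ _))
        (hc2 hh hM _), intervalIntegral.integral_add (by simp) (hc2 hf₂ hM₂ _)]
    simp [tentAverage]; ring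
  rw [e1]
  have m1 : ∀ {E : ℝ → ENNReal} (_ : Measurable E) (c : ℝ), Measurable fun w => E (c + w) :=
    fun hE c => hE.comp (measurable_const_add c)
  have hone : volume (Ioc (0 : ℝ) (1 / 4)) ≤ 1 := by
    rw [Real.volume_Ioc]; exact ENNReal.ofReal_le_one.2 (by norm_num)
  refine (enorm_intervalIntegral_le (by norm_num)
    (g := fun z => E₁ x + (∫⁻ x, E₂ x) + ∫⁻ x, E₃ x) ?_).trans ?_
  · intro z hz
    refine (enorm_intervalIntegral_le (by norm_num)
      (g := fun w => E₁ x + E₂ (0 + z + w) + E₃ (x + z + w)) ?_).trans ?_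
    · intro w hw
      have := hx.1; have := hx.2; have := hw.1; have := hw.2; have := hz.1; have := hz.2
      have := H x (z + w) (by linarith) (by linarith) (by linarith)
      rw [← add_assoc x] at this
      simpa using this
    · rw [lintegral_add_right _ (m1 hE₃ _), lintegral_add_right _ (m1 hE₂ _)]
      refine add_le_add (add_le_add ?_ (setLIntegral_Ioc_shift_le _ _ _ _))
          (setLIntegral_Ioc_shift_le _ _ _ _)
      rw [setLIntegral_const]
      exact mul_le_of_le_one_right' hone
  · rw [setLIntegral_const]
    exact mul_le_of_le_one_right' hone

/-! ### Stability of Pexider's equation -/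

lemma setLIntegral_comp_affine_le {g : ℝ → ENNReal} (c d : ℝ) (hc : c ≠ 0) (S T : Set ℝ)
    (hS : MeasurableSet S) (hT : MeasurableSet T) (h : ∀ x ∈ S, d + c * x ∈ T) :
    ∫⁻ x in S, g (d + c * x) ≤ ENNReal.ofReal |c⁻¹| * ∫⁻ x in T, g x := by
  rw [← lintegral_indicator hS, ← lintegral_indicator hT]
  have h1 : ∫⁻ x, T.indicator g (d + c * x) = ENNReal.ofReal |c⁻¹| * ∫⁻ x, T.indicator g x := by
    rw [← lintegral_add_left_eq_self (T.indicator g) d, ← smul_eq_mul, ← lintegral_smul_measure,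
      ← Real.map_volume_mul_left hc]
    exact ((Homeomorph.mulLeft₀ c hc).measurableEmbedding.lintegral_map
      (fun x => T.indicator g (d + x))).symm
  rw [← h1]
  refine lintegral_mono fun x => ?_
  by_cases hx : x ∈ S
  · simp [hx, h x hx]
  · simp [hx]

/-- Stability of Pexider's equation in `L¹`, away from the corners `x = 1` and `y = 1` of the
simplex. The tent average of `h` serves both functions, so that they get the same slope. -/
lemma pexider_stability_half {f₁ f₂ h : ℝ → ℝ} (hf₁ : Measurable f₁) (hf₂ : Measurable f₂)
    (hh : Measurable h) {M : ℝ} (hM₁ : ∀ x, |f₁ x| ≤ M) (hM₂ : ∀ x, |f₂ x| ≤ M)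
    (hM : ∀ x, |h x| ≤ M) {E₁ E₂ E₃ : ℝ → ENNReal} (hE₁ : Measurable E₁) (hE₂ : Measurable E₂)
    (hE₃ : Measurable E₃)
    (H : ∀ x y, 0 < x → 0 < y → x + y < 1 → ‖f₁ x + f₂ y - h (x + y)‖ₑ ≤ E₁ x + E₂ y + E₃ (x + y)) :
    ∃ p q κ : ℝ,
      (∫⁻ x in Ioo (0 : ℝ) (1 / 2), ‖f₁ x - (p + κ * x)‖ₑ ≤
        64 * ((∫⁻ x, E₁ x) + (∫⁻ x, E₂ x) + ∫⁻ x, E₃ x)) ∧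
      (∫⁻ x in Ioo (0 : ℝ) (1 / 2), ‖f₂ x - (q + κ * x)‖ₑ ≤
        64 * ((∫⁻ x, E₁ x) + (∫⁻ x, E₂ x) + ∫⁻ x, E₃ x)) := by
  obtain ⟨α, κ, hφ⟩ := tentAverage_near_affine hf₂ hh hM₂ hM hE₁ hE₂ hE₃ H
  set E := (∫⁻ x, E₁ x) + (∫⁻ x, E₂ x) + ∫⁻ x, E₃ x with hE
  have H' : ∀ x y, 0 < x → 0 < y → x + y < 1 →
      ‖f₂ x + f₁ y - h (x + y)‖ₑ ≤ E₂ x + E₁ y + E₃ (x + y) := by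
    intro x y hx hy hxy
    rw [add_comm (f₂ x), add_comm (E₂ x), add_comm x]
    exact H y x hy hx (by linarith)
  have n1 := fun x (hx : x ∈ Ioo (0 : ℝ) (1 / 2)) =>
    tentAverage_near_left hf₂ hh hM₂ hM hE₂ hE₃ H hx
  have n2 := fun x (hx : x ∈ Ioo (0 : ℝ) (1 / 2)) =>
    tentAverage_near_left hf₁ hh hM₁ hM hE₁ hE₃ H' hx
  have fin : ∀ (f g : ℝ → ℝ) (e : ℝ → ENNReal), Measurable e → (∫⁻ x, e x) ≤ E →
      (∀ x ∈ Ioo (0 : ℝ) (1 / 2), ‖f x / 16 + tentAverage g 0 - tentAverage h x‖ₑ ≤ e x + E) →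
      ∫⁻ x in Ioo (0 : ℝ) (1 / 2), ‖f x - (16 * (α - tentAverage g 0) + 16 * κ * x)‖ₑ ≤
        64 * E := by
    intro f g e he heE hfe
    have : ∀ x ∈ Ioo (0 : ℝ) (1 / 2),
        ‖f x - (16 * (α - tentAverage g 0) + 16 * κ * x)‖ₑ ≤ 16 * (e x + E + 2 * E) := by
      intro x hx
      have e1 : f x - (16 * (α - tentAverage g 0) + 16 * κ * x) =
          16 * ((f x / 16 + tentAverage g 0 - tentAverage h x) +
            (tentAverage h x - (α + κ * x))) := by ring
      rw [e1, enorm_mul]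
      have : ‖(16 : ℝ)‖ₑ = 16 := by
        rw [Real.enorm_eq_ofReal (by norm_num)]; simp
      rw [this]
      exact mul_le_mul_right ((enorm_add_le _ _).trans (add_le_add (hfe x hx) (hφ x hx))) _
    refine (setLIntegral_mono' measurableSet_Ioo this).trans ?_
    rw [lintegral_const_mul _ (by fun_prop)]
    have e2 : ∀ x, e x + E + 2 * E = e x + 3 * E := fun x => by ring
    simp only [e2]
    rw [lintegral_add_right _ (by fun_prop), setLIntegral_const, Real.volume_Ioo]
    have e3 : ENNReal.ofReal (1 / 2 - 0) ≤ 1 := ENNReal.ofReal_le_one.2 (by norm_num)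
    calc 16 * ((∫⁻ x in Ioo (0 : ℝ) (1 / 2), e x) + 3 * E * ENNReal.ofReal (1 / 2 - 0))
        ≤ 16 * (E + 3 * E * 1) := by
          gcongr
          exact (setLIntegral_le_lintegral _ _).trans heE
      _ = 64 * E := by ring
  refine ⟨16 * (α - tentAverage f₂ 0), 16 * (α - tentAverage f₁ 0), 16 * κ, ?_, ?_⟩
  · refine fin f₁ f₂ E₁ hE₁ (by rw [hE, add_assoc]; exact le_self_add) fun x hx =>
      (n1 x hx).trans ?_
    rw [add_assoc]; gcongr
    rw [hE, add_assoc]; exact le_add_self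
  · refine fin f₂ f₁ E₂ hE₂ (by rw [hE, add_right_comm]; exact le_add_self) fun x hx =>
      (n2 x hx).trans ?_
    rw [add_assoc]; gcongr
    rw [hE, add_right_comm]; exact le_self_add

/-- Stability of Pexider's equation `f₁ x + f₂ y = h (x + y)` on the unit simplex, in `L¹`: if the
equation holds up to an error that is a sum of integrable functions of `x`, `y` and `x + y` then
the three functions are affine with a common slope up to an error in `L¹`. Towards the corners of
the simplex the control comes from the substitutions `x = y` and `y = (1 - x) / 2`. -/
lemma pexider_stability {f₁ f₂ h : ℝ → ℝ} (hf₁ : Measurable f₁) (hf₂ : Measurable f₂)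
    (hh : Measurable h) {M : ℝ} (hM₁ : ∀ x, |f₁ x| ≤ M) (hM₂ : ∀ x, |f₂ x| ≤ M)
    (hM : ∀ x, |h x| ≤ M) {E₁ E₂ E₃ : ℝ → ENNReal} (hE₁ : Measurable E₁) (hE₂ : Measurable E₂)
    (hE₃ : Measurable E₃)
    (H : ∀ x y, 0 < x → 0 < y → x + y < 1 → ‖f₁ x + f₂ y - h (x + y)‖ₑ ≤ E₁ x + E₂ y + E₃ (x + y)) :
    ∃ p q κ : ℝ,
      (∫⁻ x in Ioo (0 : ℝ) 1, ‖f₁ x - (p + κ * x)‖ₑ ≤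
        1000 * ((∫⁻ x, E₁ x) + (∫⁻ x, E₂ x) + ∫⁻ x, E₃ x)) ∧
      (∫⁻ x in Ioo (0 : ℝ) 1, ‖f₂ x - (q + κ * x)‖ₑ ≤
        1000 * ((∫⁻ x, E₁ x) + (∫⁻ x, E₂ x) + ∫⁻ x, E₃ x)) ∧
      (∫⁻ x in Ioo (0 : ℝ) 1, ‖h x - (p + q + κ * x)‖ₑ ≤
        1000 * ((∫⁻ x, E₁ x) + (∫⁻ x, E₂ x) + ∫⁻ x, E₃ x)) := by
  obtain ⟨p, q, κ, h₁, h₂⟩ := pexider_stability_half hf₁ hf₂ hh hM₁ hM₂ hM hE₁ hE₂ hE₃ H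
  set E := (∫⁻ x, E₁ x) + (∫⁻ x, E₂ x) + ∫⁻ x, E₃ x with hE
  have l1 : (∫⁻ x, E₁ x) ≤ E := by rw [hE, add_assoc]; exact le_self_add
  have l2 : (∫⁻ x, E₂ x) ≤ E := by rw [hE, add_right_comm]; exact le_add_self
  have l3 : (∫⁻ x, E₃ x) ≤ E := by rw [hE]; exact le_add_self
  have sub : ∀ {g : ℝ → ENNReal} (c d : ℝ) (_ : c ≠ 0) (_ : |c⁻¹| ≤ 2) (T : Set ℝ)
      (_ : MeasurableSet T) (_ : ∀ x ∈ Ioo (0 : ℝ) 1, d + c * x ∈ T),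
      ∫⁻ x in Ioo (0 : ℝ) 1, g (d + c * x) ≤ 2 * ∫⁻ x in T, g x := by
    intro g c d hc hc' T hT hh
    refine (setLIntegral_comp_affine_le c d hc _ T measurableSet_Ioo hT hh).trans ?_
    gcongr
    rw [show (2 : ENNReal) = ENNReal.ofReal 2 by simp]
    exact ENNReal.ofReal_le_ofReal hc'
  have sub' : ∀ {g : ℝ → ENNReal} (c d : ℝ) (_ : c ≠ 0) (_ : |c⁻¹| ≤ 2),
      ∫⁻ x in Ioo (0 : ℝ) 1, g (d + c * x) ≤ 2 * ∫⁻ x, g x := by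
    intro g c d hc hc'
    simpa using sub (g := g) c d hc hc' univ MeasurableSet.univ (fun _ _ => mem_univ _)
  have half : |((1 / 2 : ℝ))⁻¹| ≤ 2 := by norm_num
  have mhalf : |((-1 / 2 : ℝ))⁻¹| ≤ 2 := by norm_num [abs_of_neg]
  have h₃ : ∫⁻ s in Ioo (0 : ℝ) 1, ‖h s - (p + q + κ * s)‖ₑ ≤ 261 * E := by
    have pt : ∀ s ∈ Ioo (0 : ℝ) 1, ‖h s - (p + q + κ * s)‖ₑ ≤
        (E₁ (0 + 1 / 2 * s) + E₂ (0 + 1 / 2 * s) + E₃ s) +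
        (‖f₁ (0 + 1 / 2 * s) - (p + κ * (0 + 1 / 2 * s))‖ₑ +
          ‖f₂ (0 + 1 / 2 * s) - (q + κ * (0 + 1 / 2 * s))‖ₑ) := by
      intro s hs
      have := hs.1; have := hs.2
      have hH := H (1 / 2 * s) (1 / 2 * s) (by linarith) (by linarith) (by linarith)
      rw [show 1 / 2 * s + 1 / 2 * s = s by ring] at hH
      simp only [zero_add]
      have e : h s - (p + q + κ * s) = (f₁ (1 / 2 * s) - (p + κ * (1 / 2 * s)) +
        (f₂ (1 / 2 * s) - (q + κ * (1 / 2 * s)))) - (f₁ (1 / 2 * s) + f₂ (1 / 2 * s) - h s) := by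
          ring
      rw [e, add_comm (E₁ _ + _ + _)]
      exact enorm_sub_le.trans (add_le_add (enorm_add_le _ _) hH)
    refine (setLIntegral_mono' measurableSet_Ioo pt).trans ?_
    rw [lintegral_add_left (by fun_prop), lintegral_add_left (by fun_prop),
      lintegral_add_left (by fun_prop), lintegral_add_left (by fun_prop)]
    have hT : ∀ x ∈ Ioo (0 : ℝ) 1, (0 : ℝ) + 1 / 2 * x ∈ Ioo (0 : ℝ) (1 / 2) := fun x hx =>
      ⟨by linarith [hx.1], by linarith [hx.2]⟩
    refine (add_le_add (add_le_add (add_le_add (sub' _ _ (by norm_num) half)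
      (sub' _ _ (by norm_num) half)) (setLIntegral_le_lintegral _ _))
      (add_le_add (sub (g := fun x => ‖f₁ x - (p + κ * x)‖ₑ) _ _ (by norm_num) half _
        measurableSet_Ioo hT) (sub (g := fun x => ‖f₂ x - (q + κ * x)‖ₑ) _ _ (by norm_num) half _
        measurableSet_Ioo hT))).trans ?_
    calc _ ≤ 2 * E + 2 * E + E + (2 * (64 * E) + 2 * (64 * E)) := by gcongr
      _ = 261 * E := by ring
  have fin : ∀ (f g : ℝ → ℝ) (e e' : ℝ → ENNReal) (p q : ℝ), Measurable f → Measurable g →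
      Measurable e → Measurable e' → (∫⁻ x, e x) ≤ E → (∫⁻ x, e' x) ≤ E →
      ∫⁻ x in Ioo (0 : ℝ) (1 / 2), ‖g x - (q + κ * x)‖ₑ ≤ 64 * E →
      ∫⁻ s in Ioo (0 : ℝ) 1, ‖h s - (p + q + κ * s)‖ₑ ≤ 261 * E →
      (∀ x y, 0 < x → 0 < y → x + y < 1 → ‖f x + g y - h (x + y)‖ₑ ≤ e x + e' y + E₃ (x + y)) →
      ∫⁻ x in Ioo (0 : ℝ) 1, ‖f x - (p + κ * x)‖ₑ ≤ 1000 * E := by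
    intro f g e e' p q hf hg he he' i1 i2 i3 i4 H
    have pt : ∀ x ∈ Ioo (0 : ℝ) 1, ‖f x - (p + κ * x)‖ₑ ≤
        (e x + e' (1 / 2 + -1 / 2 * x) + E₃ (1 / 2 + 1 / 2 * x)) +
        (‖h (1 / 2 + 1 / 2 * x) - (p + q + κ * (1 / 2 + 1 / 2 * x))‖ₑ +
          ‖g (1 / 2 + -1 / 2 * x) - (q + κ * (1 / 2 + -1 / 2 * x))‖ₑ) := by
      intro x hx
      have := hx.1; have := hx.2
      have hH := H x (1 / 2 + -1 / 2 * x) (by linarith) (by linarith) (by linarith)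
      rw [show x + (1 / 2 + -1 / 2 * x) = 1 / 2 + 1 / 2 * x by ring] at hH
      have e : f x - (p + κ * x) =
        (f x + g (1 / 2 + -1 / 2 * x) - h (1 / 2 + 1 / 2 * x)) +
        ((h (1 / 2 + 1 / 2 * x) - (p + q + κ * (1 / 2 + 1 / 2 * x))) -
          (g (1 / 2 + -1 / 2 * x) - (q + κ * (1 / 2 + -1 / 2 * x)))) := by
          ring
      rw [e]
      exact (enorm_add_le _ _).trans (add_le_add hH enorm_sub_le)
    refine (setLIntegral_mono' measurableSet_Ioo pt).trans ?_
    rw [lintegral_add_left (by fun_prop), lintegral_add_left (by fun_prop),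
      lintegral_add_left (by fun_prop), lintegral_add_left (by fun_prop)]
    refine (add_le_add (add_le_add (add_le_add (setLIntegral_le_lintegral _ _)
      (sub' _ _ (by norm_num) mhalf)) (sub' _ _ (by norm_num) half))
      (add_le_add (sub (g := fun x => ‖h x - (p + q + κ * x)‖ₑ) _ _ (by norm_num) half (Ioo 0 1)
        measurableSet_Ioo fun x hx => ⟨by linarith [hx.1], by linarith [hx.2]⟩)
        (sub (g := fun x => ‖g x - (q + κ * x)‖ₑ) _ _ (by norm_num) mhalf (Ioo 0 (1 / 2))
        measurableSet_Ioo fun x hx => ⟨by linarith [hx.2], by linarith [hx.1]⟩))).trans ?_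
    calc _ ≤ E + 2 * E + 2 * E + (2 * (261 * E) + 2 * (64 * E)) := by gcongr
      _ = 655 * E := by ring
      _ ≤ 1000 * E := by gcongr; norm_num
  refine ⟨p, q, κ, ?_, ?_, h₃.trans (by gcongr; norm_num)⟩
  · exact fin f₁ f₂ E₁ E₂ p q hf₁ hf₂ hE₁ hE₂ l1 l2 h₂ h₃ H
  · refine fin f₂ f₁ E₂ E₁ q p hf₂ hf₁ hE₂ hE₁ l2 l1 h₁ (by rwa [add_comm q p]) ?_
    intro x y hx hy hxy
    rw [add_comm (f₂ x), add_comm (E₂ x), add_comm x]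
    exact H y x hy hx (by linarith)

/-! ### Korn's inequality on the unit simplex from oscillations along lines -/

/-- The open unit simplex in the plane `ℝ × ℝ`. -/
def unitSimplex : Set (ℝ × ℝ) := {p | 0 < p.1 ∧ 0 < p.2 ∧ p.1 + p.2 < 1}

lemma isOpen_unitSimplex : IsOpen unitSimplex :=
  (isOpen_lt continuous_const continuous_fst).inter
    ((isOpen_lt continuous_const continuous_snd).inter
      (isOpen_lt (continuous_fst.add continuous_snd) continuous_const))

lemma measurableSet_unitSimplex : MeasurableSet unitSimplex := isOpen_unitSimplex.measurableSet

lemma lintegral_snd_mul_fst_add_snd {F G : ℝ → ENNReal} (hF : Measurable F) (hG : Measurable G) :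
    ∫⁻ p : ℝ × ℝ, F p.2 * G (p.1 + p.2) = (∫⁻ x, F x) * ∫⁻ x, G x := by
  rw [Measure.volume_eq_prod, lintegral_prod_symm _ (by fun_prop)]
  simp only
  have : ∀ y, ∫⁻ x, F y * G (x + y) = F y * ∫⁻ x, G x := fun y => by
    rw [lintegral_const_mul _ (by fun_prop), lintegral_add_right_eq_self]
  simp only [this]
  rw [lintegral_mul_const _ hF]

lemma lintegral_fst_mul_fst_add_snd {F G : ℝ → ENNReal} (hF : Measurable F) (hG : Measurable G) :
    ∫⁻ p : ℝ × ℝ, F p.1 * G (p.1 + p.2) = (∫⁻ x, F x) * ∫⁻ x, G x := by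
  rw [Measure.volume_eq_prod, lintegral_prod _ (by fun_prop)]
  simp only
  have : ∀ y, ∫⁻ x, F y * G (y + x) = F y * ∫⁻ x, G x := fun y => by
    rw [lintegral_const_mul _ (by fun_prop), lintegral_add_left_eq_self]
  simp only [this]
  rw [lintegral_mul_const _ hF]

/-- Korn's inequality on the unit simplex for fields whose directional components oscillate little
along the lines in the three edge directions. The components deviate from a rigid motion by
functions of one variable only, by the stability of Pexider's equation; in the plane the product
of two such functions of independent variables is controlled by their `L¹` norms, and the square
of each component is a sum of such products. -/
lemma korn_of_line_oscillation {u w : ℝ × ℝ → ℝ} (hu : Measurable u) (hw : Measurable w) {M : ℝ}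
    (hMu : ∀ p, |u p| ≤ M) (hMw : ∀ p, |w p| ≤ M) {A B D : ℝ → ENNReal} (hA : Measurable A)
    (hB : Measurable B) (hD : Measurable D)
    (oA : ∀ x x' y, (x, y) ∈ unitSimplex → (x', y) ∈ unitSimplex →
      ‖u (x, y) - u (x', y)‖ₑ ≤ A y)
    (oB : ∀ x y y', (x, y) ∈ unitSimplex → (x, y') ∈ unitSimplex →
      ‖w (x, y) - w (x, y')‖ₑ ≤ B x)
    (oD : ∀ x y x' y', (x, y) ∈ unitSimplex → (x', y') ∈ unitSimplex → x + y = x' + y' →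
      ‖(u (x, y) - w (x, y)) - (u (x', y') - w (x', y'))‖ₑ ≤ D (x + y)) :
    ∃ c₁ c₂ c₃ : ℝ, ∫⁻ p in unitSimplex,
      (‖u p - (c₁ - c₃ * p.2)‖ₑ ^ 2 + ‖w p - (c₂ + c₃ * p.1)‖ₑ ^ 2) ≤
        5000000 * ((∫⁻ x, A x) + (∫⁻ x, B x) + ∫⁻ x, D x) ^ 2 := by
  set E := (∫⁻ x, A x) + (∫⁻ x, B x) + ∫⁻ x, D x with hE
  set a : ℝ → ℝ := fun y => u ((1 - y) / 2, y) with ha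
  set b : ℝ → ℝ := fun x => -w (x, (1 - x) / 2) with hb
  set d : ℝ → ℝ := fun s => u (s / 2, s / 2) - w (s / 2, s / 2) with hd
  have mida : ∀ x y, (x, y) ∈ unitSimplex → ((1 - y) / 2, y) ∈ unitSimplex := by
    rintro x y ⟨h1, h2, h3⟩; simp only at h1 h2 h3
    refine ⟨?_, ?_, ?_⟩ <;> simp only <;> linarith
  have midb : ∀ x y, (x, y) ∈ unitSimplex → (x, (1 - x) / 2) ∈ unitSimplex := by
    rintro x y ⟨h1, h2, h3⟩; simp only at h1 h2 h3
    refine ⟨?_, ?_, ?_⟩ <;> simp only <;> linarith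
  have midd : ∀ x y, (x, y) ∈ unitSimplex → ((x + y) / 2, (x + y) / 2) ∈ unitSimplex := by
    rintro x y ⟨h1, h2, h3⟩; simp only at h1 h2 h3
    refine ⟨?_, ?_, ?_⟩ <;> simp only <;> linarith
  have ca : ∀ x y, (x, y) ∈ unitSimplex → ‖u (x, y) - a y‖ₑ ≤ A y := fun x y h =>
    oA _ _ _ h (mida x y h)
  have cb : ∀ x y, (x, y) ∈ unitSimplex → ‖-w (x, y) - b x‖ₑ ≤ B x := fun x y h => by
    have := oB _ _ _ h (midb x y h)
    rw [← enorm_neg, neg_sub'] at this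
    exact this
  have cd : ∀ x y, (x, y) ∈ unitSimplex → ‖(u (x, y) - w (x, y)) - d (x + y)‖ₑ ≤ D (x + y) :=
    fun x y h => oD _ _ _ _ h (midd x y h) (by ring)
  have am : Measurable a := by fun_prop
  have bm : Measurable b := by fun_prop
  have dm : Measurable d := by fun_prop
  have hM0 : 0 ≤ M := (abs_nonneg _).trans (hMu 0)
  obtain ⟨p, q, κ, i1, i2, i3⟩ := pexider_stability (f₁ := a) (f₂ := b) (h := d) (M := 2 * M)
    am bm dm
    (fun x => by have := hMu ((1 - x) / 2, x); rw [ha]; dsimp only; linarith)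
    (fun x => by have := hMw (x, (1 - x) / 2); rw [hb]; dsimp only; rw [abs_neg]; linarith)
    (fun x => by
      have h1 := hMu (x / 2, x / 2); have h2 := hMw (x / 2, x / 2)
      rw [hd]; dsimp only; exact (abs_sub _ _).trans (by linarith)) hA hB hD (by
      intro y x hy hx hxy
      have hS : (x, y) ∈ unitSimplex := ⟨hx, hy, by simp only; linarith⟩
      have e : a y + b x - d (y + x) = -(u (x, y) - a y) - (-w (x, y) - b x) +
        ((u (x, y) - w (x, y)) - d (x + y)) := by rw [add_comm y x]; ring
      rw [e, add_comm y x]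
      refine (enorm_add_le _ _).trans (add_le_add (enorm_sub_le.trans ?_) (cd x y hS))
      rw [enorm_neg]
      exact add_le_add (ca x y hS) (cb x y hS))
  have lA : (∫⁻ x, A x) ≤ E := by rw [hE, add_assoc]; exact le_self_add
  have lB : (∫⁻ x, B x) ≤ E := by rw [hE, add_right_comm]; exact le_add_self
  have lD : (∫⁻ x, D x) ≤ E := by rw [hE]; exact le_add_self
  set A' : ℝ → ENNReal := (Ioo (0 : ℝ) 1).indicator fun y => A y + ‖a y - (p + κ * y)‖ₑ with hA'
  set B' : ℝ → ENNReal := (Ioo (0 : ℝ) 1).indicator fun y => B y + ‖b y - (q + κ * y)‖ₑ with hB'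
  set D' : ℝ → ENNReal := (Ioo (0 : ℝ) 1).indicator fun y => D y + ‖d y - (p + q + κ * y)‖ₑ with hD'
  have mA : Measurable A' := Measurable.indicator (by fun_prop) measurableSet_Ioo
  have mB : Measurable B' := Measurable.indicator (by fun_prop) measurableSet_Ioo
  have mD : Measurable D' := Measurable.indicator (by fun_prop) measurableSet_Ioo
  have tot : ∀ {F : ℝ → ENNReal} {f : ℝ → ℝ} (_ : Measurable F) (_ : (∫⁻ x, F x) ≤ E)
      (_ : ∫⁻ x in Ioo (0 : ℝ) 1, ‖f x‖ₑ ≤ 1000 * E),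
      ∫⁻ x, (Ioo (0 : ℝ) 1).indicator (fun y => F y + ‖f y‖ₑ) x ≤ 1001 * E := by
    intro F f hF h1 h2
    rw [lintegral_indicator measurableSet_Ioo, lintegral_add_left hF]
    calc _ ≤ E + 1000 * E := add_le_add ((setLIntegral_le_lintegral _ _).trans h1) h2
      _ = 1001 * E := by ring
  have tA : ∫⁻ x, A' x ≤ 1001 * E := tot hA lA i1
  have tB : ∫⁻ x, B' x ≤ 1001 * E := tot hB lB i2
  have tD : ∫⁻ x, D' x ≤ 1001 * E := tot hD lD i3
  refine ⟨p, -q, -κ, ?_⟩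
  have pt : ∀ z ∈ unitSimplex, ‖u z - (p - -κ * z.2)‖ₑ ^ 2 + ‖w z - (-q + -κ * z.1)‖ₑ ^ 2 ≤
      (B' z.1 * A' z.2 + B' z.1 * A' z.2) +
        (A' z.2 * D' (z.1 + z.2) + B' z.1 * D' (z.1 + z.2)) := by
    rintro ⟨x, y⟩ hS
    obtain ⟨h1, h2, h3⟩ := id hS
    simp only at h1 h2 h3 ⊢
    have bU : ‖u (x, y) - (p - -κ * y)‖ₑ ≤ A' y := by
      rw [hA', indicator_of_mem (mem_Ioo.2 ⟨h2, by linarith⟩)]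
      refine le_trans ?_ (add_le_add (ca x y hS) le_rfl)
      refine le_trans (le_of_eq ?_) (enorm_add_le _ _)
      congr 1; ring
    have bW : ‖w (x, y) - (-q + -κ * x)‖ₑ ≤ B' x := by
      rw [hB', indicator_of_mem (mem_Ioo.2 ⟨h1, by linarith⟩)]
      refine le_trans ?_ (add_le_add (cb x y hS) le_rfl)
      refine le_trans (le_of_eq ?_) (enorm_add_le _ _)
      rw [← enorm_neg]
      congr 1; ring
    have bD : ‖(u (x, y) - (p - -κ * y)) - (w (x, y) - (-q + -κ * x))‖ₑ ≤ D' (x + y) := by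
      rw [hD', indicator_of_mem (mem_Ioo.2 ⟨by linarith, by linarith⟩)]
      refine le_trans ?_ (add_le_add (cd x y hS) le_rfl)
      refine le_trans (le_of_eq ?_) (enorm_add_le _ _)
      congr 1; ring
    generalize u (x, y) - (p - -κ * y) = U at bU bD ⊢
    generalize w (x, y) - (-q + -κ * x) = W at bW bD ⊢
    have s1 : ‖U‖ₑ ≤ B' x + D' (x + y) := by
      rw [show U = W + (U - W) by ring]
      exact (enorm_add_le _ _).trans (add_le_add bW bD)
    have s2 : ‖W‖ₑ ≤ A' y + D' (x + y) := by
      rw [show W = U - (U - W) by ring]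
      exact enorm_sub_le.trans (add_le_add bU bD)
    calc ‖U‖ₑ ^ 2 + ‖W‖ₑ ^ 2 ≤ A' y * (B' x + D' (x + y)) + B' x * (A' y + D' (x + y)) := by
          rw [sq, sq]; gcongr
      _ = _ := by ring
  refine (setLIntegral_mono' measurableSet_unitSimplex pt).trans
    ((setLIntegral_le_lintegral _ _).trans ?_)
  have m1 : Measurable fun z : ℝ × ℝ => B' z.1 * A' z.2 := by fun_prop
  rw [lintegral_add_left (by fun_prop), lintegral_add_left m1, lintegral_add_left (by fun_prop),
    lintegral_snd_mul_fst_add_snd mA mD, lintegral_fst_mul_fst_add_snd mB mD,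
    Measure.volume_eq_prod, lintegral_prod_mul mB.aemeasurable mA.aemeasurable]
  calc _ ≤ (1001 * E) * (1001 * E) + (1001 * E) * (1001 * E) +
        ((1001 * E) * (1001 * E) + (1001 * E) * (1001 * E)) := by gcongr
    _ = 4008004 * E ^ 2 := by ring
    _ ≤ 5000000 * E ^ 2 := by gcongr; norm_num

/-! ### Variation of piecewise differentiable functions of one variable -/

lemma enorm_sub_le_setLIntegral {f f' : ℝ → ℝ} (hf : ∀ s, HasDerivAt f (f' s) s)
    (hf' : Continuous f') {g : ℝ → ENNReal} {a b : ℝ} (hab : a ≤ b)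
    (hg : ∀ s ∈ Ioc a b, ‖f' s‖ₑ ≤ g s) : ‖f a - f b‖ₑ ≤ ∫⁻ s in Ioc a b, g s := by
  rw [← enorm_neg, neg_sub, ← intervalIntegral.integral_eq_sub_of_hasDerivAt (fun s _ => hf s)
    (hf'.intervalIntegrable _ _)]
  exact enorm_intervalIntegral_le hab hg

/-- If finitely many closed sets cover an interval then one of those that contain its left end
contains points further to the right. -/
lemma exists_mem_extending {ι : Type*} {K : Finset ι} {I : ι → Set ℝ}
    (hI : ∀ i ∈ K, IsClosed (I i)) {r b : ℝ} (hrb : r < b)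
    (cover : ∀ s ∈ Ioc r b, ∃ i ∈ K, s ∈ I i) :
    ∃ k ∈ K, r ∈ I k ∧ ∃ s ∈ I k, r < s := by
  set K' := K.filter fun k => ∃ s ∈ I k, r < s
  have hcl : IsClosed (⋃ k ∈ K', I k) :=
    K'.finite_toSet.isClosed_biUnion fun k hk => hI k (Finset.mem_filter.1 hk).1
  have hsub : Ioc r b ⊆ ⋃ k ∈ K', I k := by
    intro s hs
    obtain ⟨i, hi, hsi⟩ := cover s hs
    exact mem_iUnion₂.2 ⟨i, Finset.mem_filter.2 ⟨hi, s, hsi, hs.1⟩, hsi⟩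
  have : r ∈ closure (Ioc r b) := by
    rw [closure_Ioc hrb.ne]; exact left_mem_Icc.2 hrb.le
  obtain ⟨k, hk, hrk⟩ := mem_iUnion₂.1 (closure_minimal hsub hcl this)
  exact ⟨k, (Finset.mem_filter.1 hk).1, hrk, (Finset.mem_filter.1 hk).2⟩

/-- The case of `piecewise_variation` where the starting piece `i` extends to the right of `a`. It
is followed to its last point in `[a, b]`; the induction is on the number of pieces that still
extend to the right. Counting only jumps in `(a, b]` keeps those of different steps apart. -/
lemma piecewise_variation_aux {ι κ : Type*} {K : Finset ι} {I : ι → Set ℝ} {f f' : ι → ℝ → ℝ}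
    (hI : ∀ i ∈ K, IsClosed (I i)) (hI' : ∀ i ∈ K, OrdConnected (I i))
    (hf : ∀ i ∈ K, ∀ s, HasDerivAt (f i) (f' i s) s) (hf' : ∀ i ∈ K, Continuous (f' i))
    {g : ℝ → ENNReal} (hg : ∀ i ∈ K, ∀ s ∈ I i, ‖f' i s‖ₑ ≤ g s)
    {𝓔 : Finset κ} {σ : κ → ℝ} {N : κ → ENNReal} {b : ℝ} {j : ι} (hj : j ∈ K) (hbj : b ∈ I j)
    (n : ℕ) : ∀ (a : ℝ) (i : ι),
      (∀ i ∈ K, ∀ j ∈ K, i ≠ j → ∀ s ∈ Icc a b, s ∈ I i → s ∈ I j →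
        ∃ e ∈ 𝓔, σ e = s ∧ ‖f i s - f j s‖ₑ ≤ N e) →
      (∀ s ∈ Icc a b, ∃ i ∈ K, s ∈ I i) →
      i ∈ K → a ∈ I i → (∃ s ∈ I i, a < s) → a < b →
      (K.filter fun k => ∃ s ∈ I k, a < s).card ≤ n →
      ‖f i a - f j b‖ₑ ≤ (∫⁻ s in Ioc a b, g s) + ∑ e ∈ 𝓔 with σ e ∈ Ioc a b, N e := by
  induction n with
  | zero =>
    intro a i _ _ hi _ hs _ hcard
    have : i ∈ K.filter fun k => ∃ s ∈ I k, a < s := Finset.mem_filter.2 ⟨hi, hs⟩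
    simp only [nonpos_iff_eq_zero, Finset.card_eq_zero] at hcard
    rw [hcard] at this
    simp at this
  | succ n ih =>
    rintro a i jump cover hi hai ⟨s₀, hs₀, has₀⟩ hab hcard
    have hne : (I i ∩ Icc a b).Nonempty := ⟨a, hai, left_mem_Icc.2 hab.le⟩
    have hcomp : IsCompact (I i ∩ Icc a b) := isCompact_Icc.inter_left (hI i hi)
    set r := sSup (I i ∩ Icc a b) with hr
    have hrmem : r ∈ I i ∩ Icc a b := hcomp.sSup_mem hne
    have hub : ∀ s ∈ I i, s ∈ Icc a b → s ≤ r := fun s h1 h2 =>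
      le_csSup hcomp.bddAbove ⟨h1, h2⟩
    have hminI : ∀ s ∈ I i, a ≤ s → min s b ∈ I i ∧ min s b ∈ Icc a b := fun s hs has =>
      ⟨(hI' i hi).out hai hs ⟨le_min has hab.le, min_le_left _ _⟩, le_min has hab.le,
        min_le_right _ _⟩
    have har : a < r := by
      obtain ⟨h1, h2⟩ := hminI s₀ hs₀ has₀.le
      exact (lt_min has₀ hab).trans_le (hub _ h1 h2)
    have step : ‖f i a - f i r‖ₑ ≤ ∫⁻ s in Ioc a r, g s :=
      enorm_sub_le_setLIntegral (hf i hi) (hf' i hi) har.le fun s hs =>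
        hg i hi s ((hI' i hi).out hai hrmem.1 ⟨hs.1.le, hs.2⟩)
    rcases hrmem.2.2.eq_or_lt with hrb | hrb
    · rw [hrb] at step hrmem
      by_cases hij : i = j
      · subst hij; exact step.trans le_self_add
      · obtain ⟨e, he, hσ, hN⟩ := jump i hi j hj hij b (right_mem_Icc.2 hab.le) hrmem.1 hbj
        rw [← sub_add_sub_cancel (f i a) (f i b)]
        refine (enorm_add_le _ _).trans (add_le_add step (hN.trans ?_))
        exact Finset.single_le_sum (f := N) (fun _ _ => zero_le)
          (Finset.mem_filter.2 ⟨he, by rw [hσ]; exact right_mem_Ioc.2 hab⟩)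
    · obtain ⟨k, hk, hrk, hks⟩ := exists_mem_extending hI hrb fun s hs =>
        cover s ⟨har.le.trans hs.1.le, hs.2⟩
      have hno : ¬ ∃ s ∈ I i, r < s := by
        rintro ⟨s, hs, hrs⟩
        obtain ⟨h1, h2⟩ := hminI s hs (har.le.trans hrs.le)
        exact absurd (hub _ h1 h2) (not_le.2 (lt_min hrs hrb))
      have hik : i ≠ k := by rintro rfl; exact hno hks
      obtain ⟨e, he, hσ, hN⟩ := jump i hi k hk hik r hrmem.2 hrmem.1 hrk
      have hlt : (K.filter fun k => ∃ s ∈ I k, r < s) ⊂ K.filter fun k => ∃ s ∈ I k, a < s := by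
        refine Finset.ssubset_iff_subset_ne.2 ⟨fun l hl => ?_, fun heq => ?_⟩
        · obtain ⟨h1, s, h2, h3⟩ := Finset.mem_filter.1 hl
          exact Finset.mem_filter.2 ⟨h1, s, h2, har.trans h3⟩
        · have : i ∈ K.filter fun k => ∃ s ∈ I k, a < s :=
            Finset.mem_filter.2 ⟨hi, s₀, hs₀, has₀⟩
          rw [← heq] at this
          exact hno (Finset.mem_filter.1 this).2
      have := ih r k (fun i hi j hj hij s hs => jump i hi j hj hij s ⟨har.le.trans hs.1, hs.2⟩)
        (fun s hs => cover s ⟨har.le.trans hs.1, hs.2⟩) hk hrk hks hrb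
        (by have := Finset.card_lt_card hlt; omega)
      have e1 : f i a - f j b = (f i a - f i r) + (f i r - f k r) + (f k r - f j b) := by ring
      rw [e1]
      refine (enorm_add_le _ _).trans ((add_le_add ((enorm_add_le _ _).trans
        (add_le_add step hN)) this).trans ?_)
      have hint : (∫⁻ s in Ioc a r, g s) + ∫⁻ s in Ioc r b, g s = ∫⁻ s in Ioc a b, g s := by
        rw [← Ioc_union_Ioc_eq_Ioc har.le hrb.le, lintegral_union measurableSet_Ioc]
        exact Set.disjoint_left.2 fun x h1 h2 => absurd h1.2 (not_le.2 h2.1)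
      have hsum : N e + ∑ e ∈ 𝓔 with σ e ∈ Ioc r b, N e ≤ ∑ e ∈ 𝓔 with σ e ∈ Ioc a b, N e := by
        rw [← Finset.sum_insert (s := 𝓔.filter fun e => σ e ∈ Ioc r b) (a := e) (by simp [hσ])]
        refine Finset.sum_le_sum_of_subset fun e' he' => ?_
        rcases Finset.mem_insert.1 he' with rfl | h
        · exact Finset.mem_filter.2 ⟨he, by rw [hσ]; exact ⟨har, hrb.le⟩⟩
        · obtain ⟨h1, h2⟩ := Finset.mem_filter.1 h
          exact Finset.mem_filter.2 ⟨h1, har.trans h2.1, h2.2⟩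
      calc _ = ((∫⁻ s in Ioc a r, g s) + ∫⁻ s in Ioc r b, g s) +
            (N e + ∑ e ∈ 𝓔 with σ e ∈ Ioc r b, N e) := by ring
        _ ≤ _ := by rw [hint]; gcongr

/-- Variation of a piecewise `C¹` function on an interval: the difference of two values is at most
the integral of the derivatives plus the sum of the jumps. The pieces live on closed intervals
`I i` that cover `[a, b]`; where two of them meet there is a jump, listed in `𝓔` with its location
`σ` and a bound `N` for its size. -/
lemma piecewise_variation {ι κ : Type*} {K : Finset ι} {I : ι → Set ℝ} {f f' : ι → ℝ → ℝ}
    (hI : ∀ i ∈ K, IsClosed (I i)) (hI' : ∀ i ∈ K, OrdConnected (I i))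
    (hf : ∀ i ∈ K, ∀ s, HasDerivAt (f i) (f' i s) s) (hf' : ∀ i ∈ K, Continuous (f' i))
    {g : ℝ → ENNReal} (hg : ∀ i ∈ K, ∀ s ∈ I i, ‖f' i s‖ₑ ≤ g s)
    {𝓔 : Finset κ} {σ : κ → ℝ} {N : κ → ENNReal} {a b : ℝ} (hab : a ≤ b) {i j : ι}
    (hi : i ∈ K) (hai : a ∈ I i) (hj : j ∈ K) (hbj : b ∈ I j)
    (jump : ∀ i ∈ K, ∀ j ∈ K, i ≠ j → ∀ s ∈ Icc a b, s ∈ I i → s ∈ I j →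
        ∃ e ∈ 𝓔, σ e = s ∧ ‖f i s - f j s‖ₑ ≤ N e)
    (cover : ∀ s ∈ Icc a b, ∃ i ∈ K, s ∈ I i) :
    ‖f i a - f j b‖ₑ ≤ (∫⁻ s, g s) + ∑ e ∈ 𝓔, N e := by
  rcases hab.eq_or_lt with rfl | hab
  · by_cases hij : i = j
    · subst hij; simp
    · obtain ⟨e, he, -, hN⟩ := jump i hi j hj hij a (by simp) hai hbj
      exact (hN.trans (Finset.single_le_sum (f := N) (fun _ _ => zero_le) he)).trans le_add_self
  · obtain ⟨k, hk, hak, hks⟩ := exists_mem_extending hI hab fun s hs => cover s ⟨hs.1.le, hs.2⟩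
    have main := piecewise_variation_aux hI hI' hf hf' hg hj hbj _ a k jump cover hk hak hks hab
      le_rfl
    have hint : ∫⁻ s in Ioc a b, g s ≤ ∫⁻ s, g s := setLIntegral_le_lintegral _ _
    by_cases hik : i = k
    · subst hik
      exact main.trans (add_le_add hint (Finset.sum_le_sum_of_subset (Finset.filter_subset _ _)))
    · obtain ⟨e, he, hσ, hN⟩ := jump i hi k hk hik a (left_mem_Icc.2 hab.le) hai hak
      rw [← sub_add_sub_cancel (f i a) (f k a)]
      refine (enorm_add_le _ _).trans ((add_le_add hN (main.trans
        (add_le_add_left hint _))).trans ?_)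
      rw [add_left_comm, ← Finset.sum_insert (s := 𝓔.filter fun e => σ e ∈ Ioc a b) (a := e)
        (by simp [hσ])]
      gcongr
      exact Finset.insert_subset he (Finset.filter_subset _ _)

/-! ### Plane geometry: coordinates in a triangle and shape regularity -/

/-- The cross product (signed area of the parallelogram) of two vectors in the plane. -/
def cross (a b : Plane) : ℝ := a 0 * b 1 - a 1 * b 0

/-- The point with coordinates `s` and `c` in the affine frame with origin `O` and vectors `η`,
`ζ`. -/
def framePoint (O η ζ : Plane) (s c : ℝ) : Plane := O + s • η + c • ζ

lemma plane_inner (a b : Plane) : inner ℝ a b = a 0 * b 0 + a 1 * b 1 := by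
  rw [PiLp.inner_apply, Fin.sum_univ_two]; simp [mul_comm]

lemma plane_norm_sq (a : Plane) : ‖a‖ ^ 2 = a 0 ^ 2 + a 1 ^ 2 := by
  rw [← real_inner_self_eq_norm_sq, plane_inner]; ring

lemma cross_sq_add_inner_sq (a b : Plane) :
    cross a b ^ 2 + inner ℝ a b ^ 2 = ‖a‖ ^ 2 * ‖b‖ ^ 2 := by
  rw [plane_norm_sq, plane_norm_sq, plane_inner, cross]; ring

lemma abs_cross_le (a b : Plane) : |cross a b| ≤ ‖a‖ * ‖b‖ := by
  refine abs_le_of_sq_le_sq ?_ (by positivity)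
  rw [mul_pow, ← cross_sq_add_inner_sq]; nlinarith [sq_nonneg (inner ℝ a b)]

@[fun_prop]
lemma continuous_framePoint (O η ζ : Plane) :
    Continuous fun p : ℝ × ℝ => framePoint O η ζ p.1 p.2 := by
  unfold framePoint; fun_prop

/-- Change of variables to the coordinates of an affine frame. -/
lemma lintegral_framePoint (O : Plane) {η ζ : Plane} (h : cross η ζ ≠ 0) {G : Plane → ENNReal}
    (hG : Measurable G) :
    ∫⁻ p : ℝ × ℝ, G (framePoint O η ζ p.1 p.2) = ENNReal.ofReal |(cross η ζ)⁻¹| * ∫⁻ x, G x := by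
  set A : Matrix (Fin 2) (Fin 2) ℝ := !![η 0, ζ 0; η 1, ζ 1] with hA
  have hdet : A.det = cross η ζ := by rw [hA, Matrix.det_fin_two_of, cross]; ring
  have hdet0 : A.det ≠ 0 := by rwa [hdet]
  have e1 : ∀ p : ℝ × ℝ, framePoint O η ζ p.1 p.2 =
      O + WithLp.toLp 2 (Matrix.toLin' A (MeasurableEquiv.finTwoArrow.symm p)) := by
    intro p
    ext i
    fin_cases i <;>
      simp [framePoint, hA, MeasurableEquiv.finTwoArrow] <;> ring
  have m1 : Measurable fun y : Plane => G (O + y) := by fun_prop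
  have m2 : Measurable fun z : Fin 2 → ℝ => G (O + WithLp.toLp 2 z) := by fun_prop
  have m3 : Measurable (Matrix.toLin' A : (Fin 2 → ℝ) → (Fin 2 → ℝ)) :=
    (LinearMap.continuous_of_finiteDimensional _).measurable
  simp only [e1]
  rw [(volume_preserving_finTwoArrow ℝ).symm.lintegral_comp
    (f := fun z => G (O + WithLp.toLp 2 (Matrix.toLin' A z))) (m2.comp m3),
    ← lintegral_map (f := fun z => G (O + WithLp.toLp 2 z)) m2 m3,
    Real.map_matrix_volume_pi_eq_smul_volume_pi hdet0, lintegral_smul_measure,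
    (PiLp.volume_preserving_toLp (Fin 2)).lintegral_comp m1, lintegral_add_left_eq_self, hdet,
    smul_eq_mul]

section Simplex

variable (S : Affine.Simplex ℝ Plane 2)

lemma inradius_lt_height (i : Fin 3) : S.inradius < S.height i := by
  have h : ∀ i, 0 < S.height i := S.height_pos
  have hs : (S.height i)⁻¹ < ∑ j, S.excenterWeightsUnnorm ∅ j := by
    simp only [Affine.Simplex.excenterWeightsUnnorm_empty_apply]
    obtain ⟨j, hj⟩ : ∃ j : Fin 3, j ≠ i := exists_ne i
    exact Finset.single_lt_sum (f := fun j => (S.height j)⁻¹) hj (Finset.mem_univ _)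
      (Finset.mem_univ _) (inv_pos.2 (h j)) fun k _ _ => (inv_pos.2 (h k)).le
  rw [Affine.Simplex.inradius_eq_abs_inv_sum,
    abs_of_pos (inv_pos.2 S.sum_excenterWeightsUnnorm_empty_pos)]
  exact inv_lt_of_inv_lt₀ (h i) hs

/-- The square of the inradius is at most twice the area. -/
lemma inradius_sq_le_abs_cross :
    S.inradius ^ 2 ≤ |cross (S.points 1 - S.points 0) (S.points 2 - S.points 0)| := by
  have e1 := S.inner_vsub_vsub_altitudeFoot_eq_height_sq (i := 2) (j := 0) (by decide)
  have e2 := S.inner_vsub_vsub_altitudeFoot_eq_height_sq (i := 2) (j := 1) (by decide)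
  have e3 := S.inner_vsub_vsub_altitudeFoot_eq_height_sq (i := 1) (j := 0) (by decide)
  have n2 : ‖S.points 2 - S.altitudeFoot 2‖ = S.height 2 := by
    rw [Affine.Simplex.height, dist_eq_norm]
  have n1 : ‖S.points 1 - S.altitudeFoot 1‖ = S.height 1 := by
    rw [Affine.Simplex.height, dist_eq_norm]
  have h1 := S.height_pos 1
  have h2 := S.height_pos 2
  have r1 := inradius_lt_height S 1
  have r2 := inradius_lt_height S 2
  have r0 := S.inradius_pos
  simp only [vsub_eq_sub] at e1 e2 e3
  set a := S.points 1 - S.points 0 with ha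
  set b := S.points 2 - S.points 0 with hb
  set F := S.points 2 - S.altitudeFoot 2 with hF
  have e4 : inner ℝ a F = 0 := by
    have : a = b - (S.points 2 - S.points 1) := by rw [ha, hb]; abel
    rw [this, inner_sub_left, e1, e2, sub_self]
  have la : S.height 1 ≤ ‖a‖ := by
    have := real_inner_le_norm a (S.points 1 - S.altitudeFoot 1)
    rw [e3, n1, sq] at this
    exact le_of_mul_le_mul_right this h1
  have c1 : cross a b = cross a F := by
    have : cross a b * ‖F‖ ^ 2 = cross a F * inner ℝ b F - inner ℝ a F * cross b F := by
      rw [plane_norm_sq, plane_inner, plane_inner, cross, cross, cross]; ring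
    rw [n2, e1, e4, zero_mul, sub_zero] at this
    exact mul_right_cancel₀ (by positivity) this
  have c2 : |cross a b| = ‖a‖ * S.height 2 := by
    have := cross_sq_add_inner_sq a F
    rw [e4, ← c1, n2, ← mul_pow] at this
    rw [← abs_of_nonneg (a := ‖a‖ * S.height 2) (by positivity)]
    exact (sq_eq_sq_iff_abs_eq_abs _ _).1 (by linarith)
  rw [c2, sq]
  exact mul_le_mul (r1.le.trans la) r2.le r0.le (norm_nonneg _)

lemma cross_ne_zero : cross (S.points 1 - S.points 0) (S.points 2 - S.points 0) ≠ 0 := by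
  have h := inradius_sq_le_abs_cross S
  have r0 := S.inradius_pos
  rw [← abs_pos]
  exact lt_of_lt_of_le (by positivity) h

/-- In a shape regular triangle the squares of the edge lengths are at most a multiple of the
area. -/
lemma dist_sq_le_of_shapeRegular {γ : ℝ} (h : S.circumradius / S.inradius < γ) (i j : Fin 3) :
    dist (S.points i) (S.points j) ^ 2 ≤
      4 * γ ^ 2 * |cross (S.points 1 - S.points 0) (S.points 2 - S.points 0)| := by
  have r0 := S.inradius_pos
  have R0 : 0 ≤ S.circumradius := S.circumradius_nonneg
  rw [div_lt_iff₀ r0] at h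
  have hd : dist (S.points i) (S.points j) ≤ 2 * S.circumradius := by
    refine (dist_triangle_right _ _ S.circumcenter).trans ?_
    rw [S.dist_circumcenter_eq_circumradius, S.dist_circumcenter_eq_circumradius]; linarith
  calc dist (S.points i) (S.points j) ^ 2 ≤ (2 * (γ * S.inradius)) ^ 2 := by
        gcongr; linarith
    _ = 4 * γ ^ 2 * S.inradius ^ 2 := by ring
    _ ≤ _ := by gcongr; exact inradius_sq_le_abs_cross S

/-- A nondegenerate triangle as an affine basis of the plane. -/
def simplexBasis : AffineBasis (Fin 3) ℝ Plane :=
  ⟨S.points, S.independent, by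
    rw [S.independent.affineSpan_eq_top_iff_card_eq_finrank_add_one]; simp⟩

lemma coe_simplexBasis : ⇑(simplexBasis S) = S.points := rfl

lemma simplexBasis_coord_framePoint (s c : ℝ) :
    let x := framePoint (S.points 0) (S.points 1 - S.points 0) (S.points 2 - S.points 0) s c
    (simplexBasis S).coord 0 x = 1 - s - c ∧ (simplexBasis S).coord 1 x = s ∧
      (simplexBasis S).coord 2 x = c := by
  intro x
  have hx : x = Finset.univ.affineCombination ℝ (simplexBasis S) ![1 - s - c, s, c] := by
    have hw : ∑ i, ![1 - s - c, s, c] i = 1 := by simp [Fin.sum_univ_three]; ring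
    rw [Finset.affineCombination_eq_weightedVSubOfPoint_vadd_of_sum_eq_one _ _ _ hw (S.points 0)]
    simp [Fin.sum_univ_three, x, framePoint, coe_simplexBasis]
    abel
  have hw : ∑ i, ![1 - s - c, s, c] i = 1 := by simp [Fin.sum_univ_three]; ring
  refine ⟨?_, ?_, ?_⟩ <;>
    rw [hx, (simplexBasis S).coord_apply_combination_of_mem (Finset.mem_univ _) hw] <;> rfl

lemma framePoint_coord (x : Plane) :
    framePoint (S.points 0) (S.points 1 - S.points 0) (S.points 2 - S.points 0)
      ((simplexBasis S).coord 1 x) ((simplexBasis S).coord 2 x) = x := by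
  apply (simplexBasis S).ext_elem
  obtain ⟨h0, h1, h2⟩ := simplexBasis_coord_framePoint S ((simplexBasis S).coord 1 x)
    ((simplexBasis S).coord 2 x)
  have := (simplexBasis S).sum_coord_apply_eq_one x
  rw [Fin.sum_univ_three] at this
  intro i
  fin_cases i
  · simp only [Fin.zero_eta]; rw [h0]; linarith
  · exact h1
  · exact h2

lemma interior_hull_eq : interior (convexHull ℝ (range S.points)) =
    {x | ∀ i, 0 < (simplexBasis S).coord i x} :=
  (simplexBasis S).interior_convexHull

lemma framePoint_mem_interior_iff {s c : ℝ} :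
    framePoint (S.points 0) (S.points 1 - S.points 0) (S.points 2 - S.points 0) s c ∈
      interior (convexHull ℝ (range S.points)) ↔ (s, c) ∈ unitSimplex := by
  obtain ⟨h0, h1, h2⟩ := simplexBasis_coord_framePoint S s c
  rw [interior_hull_eq, mem_ofPred_eq, Fin.forall_fin_succ, Fin.forall_fin_two]
  change 0 < (simplexBasis S).coord 0 _ ∧ 0 < (simplexBasis S).coord 1 _ ∧
    0 < (simplexBasis S).coord 2 _ ↔ _
  rw [h0, h1, h2]
  simp only [unitSimplex, mem_ofPred_eq]
  constructor
  · rintro ⟨a, b, c⟩; exact ⟨b, c, by linarith⟩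
  · rintro ⟨a, b, c⟩; exact ⟨by linarith, a, b⟩

/-- Integration over a triangle in coordinates; its boundary is a null set. -/
lemma setLIntegral_unitSimplex {G : Plane → ENNReal} (hG : Measurable G) :
    ∫⁻ p in unitSimplex, G (framePoint (S.points 0) (S.points 1 - S.points 0)
        (S.points 2 - S.points 0) p.1 p.2) =
      ENNReal.ofReal |(cross (S.points 1 - S.points 0) (S.points 2 - S.points 0))⁻¹| *
        ∫⁻ x in convexHull ℝ (range S.points), G x := by
  have hm : MeasurableSet (interior (convexHull ℝ (range S.points))) :=
    isOpen_interior.measurableSet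
  have hconv : Convex ℝ (convexHull ℝ (range S.points)) := convex_convexHull _ _
  have : ∫⁻ x in convexHull ℝ (range S.points), G x =
      ∫⁻ x in interior (convexHull ℝ (range S.points)), G x :=
    (setLIntegral_congr (interior_ae_eq_of_null_frontier (hconv.addHaar_frontier volume))).symm
  rw [this, ← lintegral_indicator hm, ← lintegral_framePoint (S.points 0) (cross_ne_zero S)
    (hG.indicator hm), ← lintegral_indicator measurableSet_unitSimplex]
  refine lintegral_congr fun p => ?_
  by_cases hp : p ∈ unitSimplex
  · rw [indicator_of_mem hp, indicator_of_mem ((framePoint_mem_interior_iff S).2 hp)]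
  · rw [indicator_of_notMem hp,
      indicator_of_notMem (fun h => hp ((framePoint_mem_interior_iff S).1 h))]

lemma volume_unitSimplex_le : volume unitSimplex ≤ 1 := by
  have : unitSimplex ⊆ Ioo (0 : ℝ) 1 ×ˢ Ioo (0 : ℝ) 1 := by
    rintro ⟨x, y⟩ ⟨h1, h2, h3⟩
    simp only at h1 h2 h3
    exact ⟨⟨h1, by simp only; linarith⟩, ⟨h2, by simp only; linarith⟩⟩
  refine (measure_mono this).trans ?_
  rw [Measure.volume_eq_prod, Measure.prod_prod]; simp

lemma le_volume_unitSimplex : ENNReal.ofReal (1 / 4) ≤ volume unitSimplex := by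
  have : Ioo (0 : ℝ) (1 / 2) ×ˢ Ioo (0 : ℝ) (1 / 2) ⊆ unitSimplex := by
    rintro ⟨x, y⟩ ⟨⟨h1, h2⟩, h3, h4⟩
    simp only at h1 h2 h3 h4
    exact ⟨h1, h3, by simp only; linarith⟩
  refine le_trans ?_ (measure_mono this)
  rw [Measure.volume_eq_prod, Measure.prod_prod, Real.volume_Ioo,
    ← ENNReal.ofReal_mul (by norm_num)]
  apply ENNReal.ofReal_le_ofReal; norm_num

lemma volume_real_hull_bounds :
    volume.real (convexHull ℝ (range S.points)) ≤
      |cross (S.points 1 - S.points 0) (S.points 2 - S.points 0)| ∧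
    |cross (S.points 1 - S.points 0) (S.points 2 - S.points 0)| ≤
      4 * volume.real (convexHull ℝ (range S.points)) := by
  have h := setLIntegral_unitSimplex S (G := fun _ => 1) measurable_const
  have hc := abs_pos.2 (cross_ne_zero S)
  have hfin : volume (convexHull ℝ (range S.points)) ≠ ⊤ :=
    ((finite_range S.points).isCompact_convexHull ℝ).measure_lt_top.ne
  rw [setLIntegral_one, setLIntegral_one, abs_inv] at h
  set d := |cross (S.points 1 - S.points 0) (S.points 2 - S.points 0)|
  have h1 := volume_unitSimplex_le
  have h2 := le_volume_unitSimplex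
  rw [h, ← ENNReal.ofReal_toReal hfin, ← ENNReal.ofReal_mul (by positivity)] at h1 h2
  rw [ENNReal.ofReal_le_one] at h1
  rw [ENNReal.ofReal_le_ofReal_iff (by positivity)] at h2
  change d⁻¹ * volume.real _ ≤ 1 at h1
  change 1 / 4 ≤ d⁻¹ * volume.real _ at h2
  replace h1 := (inv_mul_le_iff₀ hc).1 h1
  replace h2 := (le_inv_mul_iff₀ hc).1 h2
  constructor <;> linarith

end Simplex

/-! ### Conforming triangulations -/

lemma isCompact_hull (s : Finset Plane) : IsCompact (hull s) :=
  s.finite_toSet.isCompact_convexHull ℝ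

lemma isClosed_hull (s : Finset Plane) : IsClosed (hull s) := (isCompact_hull s).isClosed

lemma measurableSet_hull (s : Finset Plane) : MeasurableSet (hull s) :=
  (isClosed_hull s).measurableSet

lemma convex_hull (s : Finset Plane) : Convex ℝ (hull s) := convex_convexHull _ _

lemma hull_mono {s t : Finset Plane} (h : s ⊆ t) : hull s ⊆ hull t :=
  convexHull_mono (by exact_mod_cast h)

lemma subset_hull (s : Finset Plane) : (s : Set Plane) ⊆ hull s := subset_convexHull _ _

namespace Triangulation

variable {Ω : Set Plane} (𝒯 : Triangulation Ω)

lemma range_toSimplex {t : Finset Plane} (ht : t ∈ 𝒯.triangles) :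
    range (𝒯.toSimplex t ht).points = t := by
  ext x
  simp only [mem_range, toSimplex, Finset.mem_coe]
  constructor
  · rintro ⟨i, rfl⟩; exact Subtype.coe_prop _
  · intro hx
    exact ⟨t.equivFinOfCardEq (𝒯.card_eq t ht) ⟨x, hx⟩, by simp⟩

lemma hull_eq_toSimplex {t : Finset Plane} (ht : t ∈ 𝒯.triangles) :
    hull t = convexHull ℝ (range (𝒯.toSimplex t ht).points) := by
  rw [range_toSimplex]; rfl

variable {𝒯}

/-- The vertices of a triangle can be numbered as one likes. -/
lemma exists_simplex {t : Finset Plane} (ht : t ∈ 𝒯.triangles) {p q : Plane} (hpq : p ≠ q)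
    (hp : p ∈ t) (hq : q ∈ t) :
    ∃ S : Affine.Simplex ℝ Plane 2, S.points 0 = p ∧ S.points 1 = q ∧
      range S.points = t := by
  have hcard : ((t.erase p).erase q).card = 1 := by
    rw [Finset.card_erase_of_mem (Finset.mem_erase.2 ⟨hpq.symm, hq⟩), Finset.card_erase_of_mem hp,
      𝒯.card_eq t ht]
  obtain ⟨a, ha⟩ := Finset.card_eq_one.1 hcard
  have haa : a ∈ (t.erase p).erase q := by rw [ha]; simp
  simp only [Finset.mem_erase] at haa
  obtain ⟨haq, hap, hat⟩ := haa
  have hmem : ∀ i, ![p, q, a] i ∈ t := by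
    intro i; fin_cases i <;> simp [hp, hq, hat]
  have hinj : Function.Injective ![p, q, a] := by
    intro i j hij
    fin_cases i <;> fin_cases j <;> simp_all
  let f : Fin 3 ↪ t := ⟨fun i => ⟨![p, q, a] i, hmem i⟩, fun i j h => hinj (congrArg Subtype.val h)⟩
  refine ⟨⟨![p, q, a], (𝒯.indep t ht).comp_embedding f⟩, rfl, rfl, ?_⟩
  have h1 : Finset.univ.image ![p, q, a] ⊆ t := fun x hx => by
    obtain ⟨i, -, rfl⟩ := Finset.mem_image.1 hx; exact hmem i
  have h2 : Finset.univ.image ![p, q, a] = t := by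
    refine Finset.eq_of_subset_of_card_le h1 ?_
    rw [Finset.card_image_of_injective _ hinj, 𝒯.card_eq t ht]; simp
  simp only
  rw [← h2]; simp

/-- A proper face of a triangle does not meet its interior. -/
lemma eq_of_mem_interior {s t : Finset Plane} (ht : t ∈ 𝒯.triangles) (hst : s ⊆ t) {x : Plane}
    (hx : x ∈ interior (hull t)) (hxs : x ∈ hull s) : s = t := by
  refine hst.antisymm fun v hv => ?_
  by_contra hvs
  have hv' : v ∈ range (𝒯.toSimplex t ht).points := by
    rw [range_toSimplex]; exact hv
  obtain ⟨i, rfl⟩ := hv'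
  set S := 𝒯.toSimplex t ht with hS
  rw [𝒯.hull_eq_toSimplex ht, ← hS, interior_hull_eq] at hx
  have hsub : hull s ⊆ {y | (simplexBasis S).coord i y ≤ 0} := by
    refine convexHull_min (fun y hy => ?_)
      ((convex_Iic (0 : ℝ)).affine_preimage ((simplexBasis S).coord i))
    have : y ∈ range S.points := by rw [hS, range_toSimplex]; exact hst hy
    obtain ⟨j, rfl⟩ := this
    have hij : i ≠ j := by rintro rfl; exact hvs hy
    change (simplexBasis S).coord i (simplexBasis S j) ≤ 0
    rw [AffineBasis.coord_apply_ne _ hij]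
  exact absurd (hx i) (not_lt.2 (hsub hxs))

lemma eq_of_mem_interior_of_mem {s t : Finset Plane} (hs : s ∈ 𝒯.triangles)
    (ht : t ∈ 𝒯.triangles) {x : Plane} (hx : x ∈ interior (hull t)) (hxs : x ∈ hull s) : s = t := by
  have h1 : x ∈ hull (s ∩ t) := by
    rw [← 𝒯.conforming s hs t ht]; exact ⟨hxs, interior_subset hx⟩
  have h2 := eq_of_mem_interior ht Finset.inter_subset_right hx h1
  exact (Finset.eq_of_subset_of_card_le (Finset.inter_eq_right.1 h2)
    (by rw [𝒯.card_eq s hs, 𝒯.card_eq t ht])).symm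

lemma volume_inter_hull {s t : Finset Plane} (hs : s ∈ 𝒯.triangles)
    (ht : t ∈ 𝒯.triangles) (hst : s ≠ t) : volume (hull s ∩ hull t) = 0 := by
  refine measure_mono_null ?_ ((convex_hull t).addHaar_frontier volume)
  rintro x ⟨h1, h2⟩
  rw [(isClosed_hull t).frontier_eq]
  exact ⟨h2, fun h => hst (eq_of_mem_interior_of_mem hs ht h h1)⟩

/-- Two different triangles with a common edge lie on different sides of it. -/
lemma cross_mul_cross_neg {t₁ t₂ : Finset Plane} (h₁ : t₁ ∈ 𝒯.triangles)
    (h₂ : t₂ ∈ 𝒯.triangles) (h : t₁ ≠ t₂) {p q a b : Plane} (hpq : p ≠ q) (hp : p ∈ t₁ ∩ t₂)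
    (hq : q ∈ t₁ ∩ t₂) (ha : a ∈ t₁) (hap : a ≠ p) (haq : a ≠ q) (hb : b ∈ t₂) (hbp : b ≠ p)
    (hbq : b ≠ q) : cross (q - p) (a - p) * cross (q - p) (b - p) < 0 := by
  rw [Finset.mem_inter] at hp hq
  have third : ∀ {t : Finset Plane} (ht : t ∈ 𝒯.triangles) (hp : p ∈ t) (hq : q ∈ t) {c : Plane}
      (hc : c ∈ t) (hcp : c ≠ p) (hcq : c ≠ q), ∃ S : Affine.Simplex ℝ Plane 2,
        S.points 0 = p ∧ S.points 1 = q ∧ S.points 2 = c ∧ range S.points = t := by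
    intro t ht hp hq c hc hcp hcq
    obtain ⟨S, h0, h1, hr⟩ := exists_simplex ht hpq hp hq
    refine ⟨S, h0, h1, ?_, hr⟩
    have : c ∈ range S.points := by rw [hr]; exact hc
    obtain ⟨i, rfl⟩ := this
    fin_cases i
    · exact absurd h0 hcp
    · exact absurd h1 hcq
    · rfl
  obtain ⟨S, rfl, rfl, rfl, hS⟩ := third h₁ hp.1 hq.1 ha hap haq
  obtain ⟨S', hS0, hS1, hS2, hS'⟩ := third h₂ hp.2 hq.2 hb hbp hbq
  have c1 := cross_ne_zero S
  have c2 := cross_ne_zero S'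
  rw [hS0, hS1, hS2] at c2
  refine lt_of_le_of_ne (not_lt.1 fun hpos => h ?_) (mul_ne_zero c1 c2)
  -- A point close to the midpoint of the edge would lie in both triangles.
  set s := (simplexBasis S).coord 1 b
  set c := (simplexBasis S).coord 2 b
  have hbc : framePoint (S.points 0) (S.points 1 - S.points 0) (S.points 2 - S.points 0) s c = b :=
    framePoint_coord S b
  set p := S.points 0
  set q := S.points 1
  set a := S.points 2
  have hcr : cross (q - p) (b - p) = c * cross (q - p) (a - p) := by
    rw [← hbc]; simp [framePoint, cross]; ring
  have hc0 : 0 < c := by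
    rw [hcr] at hpos
    nlinarith [mul_self_pos.2 c1]
  set ε : ℝ := 1 / (4 * (1 + |s| + c)) with hε
  have hs0 := abs_nonneg s
  have hsle := neg_abs_le s
  have hsle' := le_abs_self s
  have hden : 0 < 1 + |s| + c := by positivity
  have hε0 : 0 < ε := by positivity
  have hε1 : ε * (1 + |s| + c) = 1 / 4 := by rw [hε]; field_simp
  have hx : framePoint p (q - p) (a - p) ((1 - ε) / 2 + ε * s) (ε * c) =
      (1 - ε) • ((1 / 2 : ℝ) • p + (1 / 2 : ℝ) • q) + ε • b := by
    rw [← hbc]; simp only [framePoint]; module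
  have hxi : framePoint p (q - p) (a - p) ((1 - ε) / 2 + ε * s) (ε * c) ∈ interior (hull t₁) := by
    have : hull t₁ = convexHull ℝ (range S.points) := by rw [hS]; rfl
    rw [this, framePoint_mem_interior_iff]
    refine ⟨?_, ?_, ?_⟩ <;> simp only
    · nlinarith
    · positivity
    · nlinarith
  have hxb : framePoint p (q - p) (a - p) ((1 - ε) / 2 + ε * s) (ε * c) ∈ hull t₂ := by
    rw [hx]
    refine convex_hull t₂ ?_ (subset_hull _ hb) ?_ hε0.le (by ring)
    · exact convex_hull t₂ (subset_hull _ hp.2) (subset_hull _ hq.2) (by norm_num) (by norm_num)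
        (by norm_num)
    · nlinarith
  exact (eq_of_mem_interior_of_mem h₂ h₁ hxi hxb).symm

/-- At most two triangles share an edge: of three, two would lie on the same side of it. -/
lemma eq_or_eq_of_common_edge {t₁ t₂ t₃ : Finset Plane} (h₁ : t₁ ∈ 𝒯.triangles)
    (h₂ : t₂ ∈ 𝒯.triangles) (h₃ : t₃ ∈ 𝒯.triangles) (h : t₁ ≠ t₂) {e : Finset Plane}
    (he : e.card = 2) (e₁ : e ⊆ t₁) (e₂ : e ⊆ t₂) (e₃ : e ⊆ t₃) : t₃ = t₁ ∨ t₃ = t₂ := by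
  by_contra! hne
  obtain ⟨p, q, hpq, rfl⟩ := Finset.card_eq_two.1 he
  have hp : p ∈ ({p, q} : Finset Plane) := by simp
  have hq : q ∈ ({p, q} : Finset Plane) := by simp
  have third : ∀ {t : Finset Plane} (_ : t ∈ 𝒯.triangles), ∃ c ∈ t, c ≠ p ∧ c ≠ q := by
    intro t ht
    by_contra! hc
    have : t ⊆ {p, q} := fun x hx => by
      by_cases hxp : x = p
      · simp [hxp]
      · simp [hc x hx hxp]
    have := Finset.card_le_card this
    rw [𝒯.card_eq t ht, he] at this
    omega
  obtain ⟨a, ha, hap, haq⟩ := third h₁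
  obtain ⟨b, hb, hbp, hbq⟩ := third h₂
  obtain ⟨c, hc, hcp, hcq⟩ := third h₃
  have i1 := cross_mul_cross_neg h₁ h₂ h hpq (Finset.mem_inter.2 ⟨e₁ hp, e₂ hp⟩)
    (Finset.mem_inter.2 ⟨e₁ hq, e₂ hq⟩) ha hap haq hb hbp hbq
  have i2 := cross_mul_cross_neg h₁ h₃ hne.1.symm hpq (Finset.mem_inter.2 ⟨e₁ hp, e₃ hp⟩)
    (Finset.mem_inter.2 ⟨e₁ hq, e₃ hq⟩) ha hap haq hc hcp hcq
  have i3 := cross_mul_cross_neg h₂ h₃ hne.2.symm hpq (Finset.mem_inter.2 ⟨e₂ hp, e₃ hp⟩)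
    (Finset.mem_inter.2 ⟨e₂ hq, e₃ hq⟩) hb hbp hbq hc hcp hcq
  nlinarith [mul_pos_of_neg_of_neg i1 i2, mul_self_nonneg (cross (q - p) (a - p))]

/-- The jump over an edge is the difference of the two pieces, up to sign. -/
lemma jump_eq_or {t₁ t₂ : Finset Plane} (h₁ : t₁ ∈ 𝒯.triangles) (h₂ : t₂ ∈ 𝒯.triangles)
    (h : t₁ ≠ t₂) {e : Finset Plane} (he : e.card = 2) (e₁ : e ⊆ t₁) (e₂ : e ⊆ t₂)
    (v : Plane → Plane) :
    jump 𝒯 v e = piece v t₁ - piece v t₂ ∨ jump 𝒯 v e = piece v t₂ - piece v t₁ := by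
  have hex : ∃ T : Finset Plane × Finset Plane, T.1 ∈ 𝒯.triangles ∧ T.2 ∈ 𝒯.triangles ∧
      T.1 ≠ T.2 ∧ e ⊆ T.1 ∧ e ⊆ T.2 := ⟨(t₁, t₂), h₁, h₂, h, e₁, e₂⟩
  rw [jump, dif_pos hex]
  obtain ⟨i1, i2, i3, i4, i5⟩ := hex.choose_spec
  rcases eq_or_eq_of_common_edge h₁ h₂ i1 h he e₁ e₂ i4 with j1 | j1 <;>
    rcases eq_or_eq_of_common_edge h₁ h₂ i2 h he e₁ e₂ i5 with j2 | j2
  · exact absurd (j1.trans j2.symm) i3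
  · left; rw [j1, j2]
  · right; rw [j1, j2]
  · exact absurd (j1.trans j2.symm) i3

variable {𝒯H 𝒯h : Triangulation Ω}

lemma mem_trianglesIn_of_mem_interior (href : 𝒯H.IsRefinement 𝒯h) {T t : Finset Plane}
    (hT : T ∈ 𝒯H.triangles) (ht : t ∈ 𝒯h.triangles) {x : Plane} (hx : x ∈ interior (hull T))
    (hxt : x ∈ hull t) : t ∈ 𝒯h.trianglesIn T := by
  obtain ⟨T', hT', hsub⟩ := href t ht
  rw [eq_of_mem_interior_of_mem hT' hT hx (hsub hxt)] at hsub
  exact Finset.mem_filter.2 ⟨ht, hsub⟩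

/-- The fine triangles inside a coarse triangle cover its interior. -/
lemma exists_mem_trianglesIn (href : 𝒯H.IsRefinement 𝒯h) {T : Finset Plane}
    (hT : T ∈ 𝒯H.triangles) {x : Plane} (hx : x ∈ interior (hull T)) :
    ∃ t ∈ 𝒯h.trianglesIn T, x ∈ hull t := by
  have h1 : x ∈ ⋃ t ∈ 𝒯h.triangles, hull t := by
    rw [𝒯h.covers, ← 𝒯H.covers]
    exact mem_iUnion₂.2 ⟨T, hT, interior_subset hx⟩
  obtain ⟨t, ht, hxt⟩ := mem_iUnion₂.1 h1
  exact ⟨t, mem_trianglesIn_of_mem_interior href hT ht hx hxt, hxt⟩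

/-- Where two fine triangles meet inside a coarse triangle and away from the vertices, they share an
interior edge. -/
lemma inter_mem_interiorEdgesIn {T t₁ t₂ : Finset Plane}
    (h₁ : t₁ ∈ 𝒯h.trianglesIn T) (h₂ : t₂ ∈ 𝒯h.trianglesIn T) (h : t₁ ≠ t₂) {x : Plane}
    (hx : x ∈ interior (hull T)) (x₁ : x ∈ hull t₁) (x₂ : x ∈ hull t₂) (hv : x ∉ t₁) :
    (t₁ ∩ t₂).card = 2 ∧ t₁ ∩ t₂ ∈ 𝒯h.interiorEdgesIn T ∧ x ∈ hull (t₁ ∩ t₂) := by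
  obtain ⟨m₁, s₁⟩ := Finset.mem_filter.1 h₁
  obtain ⟨m₂, s₂⟩ := Finset.mem_filter.1 h₂
  have hxe : x ∈ hull (t₁ ∩ t₂) := by rw [← 𝒯h.conforming t₁ m₁ t₂ m₂]; exact ⟨x₁, x₂⟩
  have hlt : (t₁ ∩ t₂).card < 3 := by
    rw [← 𝒯h.card_eq t₁ m₁]
    refine Finset.card_lt_card (Finset.ssubset_iff_subset_ne.2
      ⟨Finset.inter_subset_left, fun he => h ?_⟩)
    exact Finset.eq_of_subset_of_card_le (Finset.inter_eq_left.1 he)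
      (by rw [𝒯h.card_eq t₁ m₁, 𝒯h.card_eq t₂ m₂])
  have hne0 : (t₁ ∩ t₂).card ≠ 0 := by
    intro h0
    rw [Finset.card_eq_zero.1 h0] at hxe
    simp [hull] at hxe
  have hne1 : (t₁ ∩ t₂).card ≠ 1 := by
    intro h1
    obtain ⟨y, hy⟩ := Finset.card_eq_one.1 h1
    have hyt : y ∈ t₁ ∩ t₂ := by rw [hy]; simp
    rw [hy] at hxe
    simp only [hull, Finset.coe_singleton, convexHull_singleton, mem_singleton_iff] at hxe
    rw [hxe] at hv
    exact hv (Finset.mem_inter.1 hyt).1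
  have hcard : (t₁ ∩ t₂).card = 2 := by omega
  refine ⟨hcard, Finset.mem_filter.2 ⟨Finset.mem_biUnion.2 ⟨t₁, m₁,
    Finset.mem_powersetCard.2 ⟨Finset.inter_subset_left, hcard⟩⟩,
    (hull_mono Finset.inter_subset_left).trans s₁, fun hf => ?_⟩, hxe⟩
  exact (hf hxe).2 hx

lemma exists_mem_trianglesIn_of_edge (href : 𝒯H.IsRefinement 𝒯h) {T e : Finset Plane}
    (hT : T ∈ 𝒯H.triangles) (he : e ∈ 𝒯h.interiorEdgesIn T) :
    ∃ t ∈ 𝒯h.trianglesIn T, e ∈ t.powersetCard 2 := by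
  obtain ⟨h1, h2, h3⟩ := Finset.mem_filter.1 he
  obtain ⟨t, ht, het⟩ := Finset.mem_biUnion.1 h1
  obtain ⟨x, hx, hxf⟩ := not_subset.1 h3
  have hxi : x ∈ interior (hull T) := by
    by_contra hxi
    exact hxf (by rw [(isClosed_hull T).frontier_eq]; exact ⟨h2 hx, hxi⟩)
  exact ⟨t, mem_trianglesIn_of_mem_interior href hT ht hxi
    (hull_mono (Finset.mem_powersetCard.1 het).1 hx), het⟩

lemma volume_hull_ne_top (t : Finset Plane) : volume (hull t) ≠ ⊤ :=
  (isCompact_hull t).measure_lt_top.ne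

lemma sum_volume_trianglesIn_le (T : Finset Plane) :
    ∑ t ∈ 𝒯h.trianglesIn T, volume.real (hull t) ≤ volume.real (hull T) := by
  have h1 : ∑ t ∈ 𝒯h.trianglesIn T, volume (hull t) ≤ volume (hull T) := by
    rw [← measure_biUnion_finset₀ (s := 𝒯h.trianglesIn T) (f := hull)
      (fun s hs t ht hst => volume_inter_hull (Finset.mem_filter.1 hs).1
        (Finset.mem_filter.1 ht).1 hst)
      fun t _ => (measurableSet_hull t).nullMeasurableSet]
    exact measure_mono (iUnion₂_subset fun t ht => (Finset.mem_filter.1 ht).2)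
  have h2 := ENNReal.toReal_mono (volume_hull_ne_top T) h1
  rwa [ENNReal.toReal_sum fun t _ => volume_hull_ne_top t] at h2

lemma edgeLength_pair (p q : Plane) : edgeLength {p, q} = dist p q := by
  rw [edgeLength, hull, convexHull_diam]; simp [Metric.diam_pair]

/-- Each squared edge length of a shape regular triangle is at most a multiple of its area. -/
lemma edgeLength_sq_le {γ₀ : ℝ} (h : 𝒯h.ShapeRegular γ₀) {t e : Finset Plane}
    (ht : t ∈ 𝒯h.triangles) (he : e ∈ t.powersetCard 2) :
    edgeLength e ^ 2 ≤ 16 * γ₀ ^ 2 * volume.real (hull t) := by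
  obtain ⟨h1, h2⟩ := Finset.mem_powersetCard.1 he
  obtain ⟨p, q, hpq, rfl⟩ := Finset.card_eq_two.1 h2
  have mem : ∀ x ∈ ({p, q} : Finset Plane), x ∈ range (𝒯h.toSimplex t ht).points := fun x hx => by
    rw [range_toSimplex]; exact h1 hx
  obtain ⟨i, hi⟩ := mem p (by simp)
  obtain ⟨j, hj⟩ := mem q (by simp)
  rw [edgeLength_pair, ← hi, ← hj]
  have := (volume_real_hull_bounds (𝒯h.toSimplex t ht)).2
  rw [← hull_eq_toSimplex] at this
  refine (dist_sq_le_of_shapeRegular _ (h t ht) i j).trans ?_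
  nlinarith [sq_nonneg γ₀]

lemma sum_edgeLength_sq_le {γ₀ : ℝ} (h : 𝒯h.ShapeRegular γ₀) (href : 𝒯H.IsRefinement 𝒯h)
    {T : Finset Plane} (hT : T ∈ 𝒯H.triangles) :
    ∑ e ∈ 𝒯h.interiorEdgesIn T, edgeLength e ^ 2 ≤ 48 * γ₀ ^ 2 * volume.real (hull T) := by
  have hsub : ∀ e ∈ 𝒯h.interiorEdgesIn T, edgeLength e ^ 2 ≤
      ∑ t ∈ 𝒯h.trianglesIn T, if e ∈ t.powersetCard 2 then edgeLength e ^ 2 else 0 := by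
    intro e he
    obtain ⟨t, ht, het⟩ := exists_mem_trianglesIn_of_edge href hT he
    refine le_trans (le_of_eq ?_) (Finset.single_le_sum
      (f := fun t : Finset Plane => if e ∈ t.powersetCard 2 then edgeLength e ^ 2 else 0)
      (fun t _ => by split_ifs <;> positivity) ht)
    rw [if_pos het]
  refine (Finset.sum_le_sum hsub).trans ?_
  rw [Finset.sum_comm]
  have htri : ∀ t ∈ 𝒯h.trianglesIn T, (∑ e ∈ 𝒯h.interiorEdgesIn T,
      if e ∈ t.powersetCard 2 then edgeLength e ^ 2 else 0) ≤
        48 * γ₀ ^ 2 * volume.real (hull t) := by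
    intro t ht
    have htm := (Finset.mem_filter.1 ht).1
    rw [← Finset.sum_filter]
    have hle : ((𝒯h.interiorEdgesIn T).filter fun e => e ∈ t.powersetCard 2).card ≤ 3 := by
      refine (Finset.card_le_card fun e he => (Finset.mem_filter.1 he).2).trans ?_
      rw [Finset.card_powersetCard, 𝒯h.card_eq t htm]; decide
    refine (Finset.sum_le_card_nsmul _ _ (16 * γ₀ ^ 2 * volume.real (hull t)) fun e he =>
      edgeLength_sq_le h htm (Finset.mem_filter.1 he).2).trans ?_
    rw [nsmul_eq_mul]
    have : (((𝒯h.interiorEdgesIn T).filter fun e => e ∈ t.powersetCard 2).card : ℝ) ≤ 3 := by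
      exact_mod_cast hle
    calc _ ≤ 3 * (16 * γ₀ ^ 2 * volume.real (hull t)) := by gcongr
      _ = _ := by ring
  refine (Finset.sum_le_sum htri).trans ?_
  rw [← Finset.mul_sum]
  gcongr
  exact sum_volume_trianglesIn_le T

end Triangulation

/-! ### Traces on edges and crossings of edges by lines -/

lemma contDiff_eval_plane (p : MvPolynomial (Fin 2) ℝ) :
    ContDiff ℝ 2 fun x : Plane => p.eval fun j => x j := by
  induction p using MvPolynomial.induction_on with
  | C a => simpa using contDiff_const
  | add p q hp hq => simpa using hp.add hq
  | mul_X p i hp =>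
    simp only [map_mul, MvPolynomial.eval_X]
    exact hp.mul (by fun_prop)

lemma contDiff_polyField (p : Fin 2 → MvPolynomial (Fin 2) ℝ) : ContDiff ℝ 2 (polyField p) := by
  rw [contDiff_euclidean]
  intro i
  fin_cases i
  · simpa [polyField] using contDiff_eval_plane (p 0)
  · simpa [polyField] using contDiff_eval_plane (p 1)

lemma contDiff_piece (v : Plane → Plane) (t : Finset Plane) : ContDiff ℝ 2 (piece v t) := by
  unfold piece
  split_ifs
  · exact contDiff_polyField _
  · exact contDiff_const

lemma continuous_piece (v : Plane → Plane) (t : Finset Plane) : Continuous (piece v t) :=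
  (contDiff_piece v t).continuous

lemma continuous_jump {Ω : Set Plane} (𝒯 : Triangulation Ω) (v : Plane → Plane)
    (e : Finset Plane) : Continuous (jump 𝒯 v e) := by
  unfold jump
  split_ifs
  · exact (continuous_piece v _).sub (continuous_piece v _)
  · exact continuous_const

/-- The Frobenius norm of the symmetric gradient. -/
def strainNorm (w : Plane → Plane) (x : Plane) : ℝ := √(∑ i, ∑ j, symGrad w x i j ^ 2)

lemma strainNorm_sq (w : Plane → Plane) (x : Plane) :
    strainNorm w x ^ 2 = ∑ i, ∑ j, symGrad w x i j ^ 2 :=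
  Real.sq_sqrt (by positivity)

lemma continuous_strainNorm {w : Plane → Plane} (hw : ContDiff ℝ 2 w) :
    Continuous (strainNorm w) := by
  have h : Continuous (fderiv ℝ w) := hw.continuous_fderiv (by norm_num)
  unfold strainNorm symGrad
  fun_prop

/-- Only the symmetric part of the gradient enters the derivative of a directional component along
its own direction. -/
lemma abs_inner_fderiv_le (w : Plane → Plane) (x η : Plane) :
    |inner ℝ (fderiv ℝ w x η) η| ≤ ‖η‖ ^ 2 * strainNorm w x := by
  set a := fun i j => fderiv ℝ w x (EuclideanSpace.single j 1) i with ha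
  have hη : η = η 0 • EuclideanSpace.single 0 1 + η 1 • EuclideanSpace.single 1 1 := by
    ext i; fin_cases i <;> simp
  have e1 : ∀ i, fderiv ℝ w x η i = η 0 * a i 0 + η 1 * a i 1 := by
    intro i
    conv_lhs => rw [hη]
    simp [ha]
  have e2 : strainNorm w x ^ 2 = a 0 0 ^ 2 + 2 * ((a 0 1 + a 1 0) / 2) ^ 2 + a 1 1 ^ 2 := by
    rw [strainNorm_sq]
    simp only [Fin.sum_univ_two, symGrad]
    change ((a 0 0 + a 0 0) / 2) ^ 2 + ((a 0 1 + a 1 0) / 2) ^ 2 +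
      (((a 1 0 + a 0 1) / 2) ^ 2 + ((a 1 1 + a 1 1) / 2) ^ 2) = _
    ring
  have h0 : 0 ≤ strainNorm w x := Real.sqrt_nonneg _
  refine abs_le_of_sq_le_sq ?_ (by positivity)
  rw [mul_pow, e2, plane_inner, e1, e1, plane_norm_sq]
  set b := (a 0 1 + a 1 0) / 2 with hb
  have e3 : (η 0 * a 0 0 + η 1 * a 0 1) * η 0 + (η 0 * a 1 0 + η 1 * a 1 1) * η 1 =
      η 0 ^ 2 * a 0 0 + 2 * (η 0 * η 1) * b + η 1 ^ 2 * a 1 1 := by rw [hb]; ring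
  rw [e3]
  generalize η 0 = m
  generalize η 1 = n
  nlinarith [sq_nonneg (m ^ 2 * b - m * n * a 0 0), sq_nonneg (m ^ 2 * a 1 1 - n ^ 2 * a 0 0),
    sq_nonneg (n ^ 2 * b - m * n * a 1 1)]

/-- Integration over a segment with respect to arc length. -/
lemma setLIntegral_hull_pair (p q : Plane) {F : Plane → ENNReal} (hF : Measurable F) :
    ∫⁻ x in hull {p, q}, F x ∂(Measure.hausdorffMeasure 1) =
      ENNReal.ofReal (dist p q) * ∫⁻ τ in Icc (0 : ℝ) 1, F (AffineMap.lineMap p q τ) := by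
  have hm : Measurable (AffineMap.lineMap p q : ℝ → Plane) :=
    (AffineMap.lineMap_continuous (R := ℝ)).measurable
  have hseg : hull {p, q} = AffineMap.lineMap p q '' Icc (0 : ℝ) 1 := by
    rw [hull, Finset.coe_pair, convexHull_pair, segment_eq_image_lineMap]
  have : (Measure.hausdorffMeasure 1 : Measure Plane).restrict (hull {p, q}) =
      ENNReal.ofReal (dist p q) • Measure.map (AffineMap.lineMap p q : ℝ → Plane)
        (volume.restrict (Icc (0 : ℝ) 1)) := by
    ext s hs
    rw [Measure.restrict_apply hs, Measure.smul_apply, Measure.map_apply hm hs,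
      Measure.restrict_apply (hm hs), hseg, ← image_preimage_inter, hausdorffMeasure_lineMap_image,
      hausdorffMeasure_real, ← edist_dist, edist_nndist]
    rfl
  rw [this, lintegral_smul_measure, lintegral_map hF hm, smul_eq_mul]

/-- The coordinate of a point transversal to the lines in direction `η`. -/
def level (O η ζ x : Plane) : ℝ := cross η (x - O) / cross η ζ

lemma level_framePoint (O : Plane) {η ζ : Plane} (h : cross η ζ ≠ 0) (s c : ℝ) :
    level O η ζ (framePoint O η ζ s c) = c := by
  rw [level, div_eq_iff h]
  simp [framePoint, cross]; ring

lemma level_lineMap (O η ζ p q : Plane) (τ : ℝ) :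
    level O η ζ (AffineMap.lineMap p q τ) =
      level O η ζ p + τ * (level O η ζ q - level O η ζ p) := by
  simp only [level, ← sub_div, ← mul_div_assoc, ← add_div]
  congr 1
  simp [AffineMap.lineMap_apply, cross]; ring

lemma exists_lineMap_of_mem_hull {p q x : Plane} (hx : x ∈ hull {p, q}) :
    ∃ τ ∈ Icc (0 : ℝ) 1, AffineMap.lineMap p q τ = x := by
  rw [hull, Finset.coe_pair, convexHull_pair, segment_eq_image_lineMap] at hx
  exact hx

/-- A line that avoids an endpoint of an edge meets the edge at most once. -/
lemma eq_of_mem_hull_pair (O : Plane) {η ζ : Plane} (h : cross η ζ ≠ 0) {p q : Plane}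
    {s s' c : ℝ} (hc : c ≠ level O η ζ p) (hs : framePoint O η ζ s c ∈ hull {p, q})
    (hs' : framePoint O η ζ s' c ∈ hull {p, q}) : s = s' := by
  obtain ⟨τ, -, hτ⟩ := exists_lineMap_of_mem_hull hs
  obtain ⟨τ', -, hτ'⟩ := exists_lineMap_of_mem_hull hs'
  have e1 := level_lineMap O η ζ p q τ
  have e2 := level_lineMap O η ζ p q τ'
  rw [hτ, level_framePoint O h] at e1
  rw [hτ', level_framePoint O h] at e2
  have hne : level O η ζ q - level O η ζ p ≠ 0 := by
    intro h0; rw [h0, mul_zero, add_zero] at e1; exact hc e1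
  have hττ : τ = τ' := mul_right_cancel₀ hne (by linarith)
  rw [hττ, hτ'] at hτ
  have h0 : (s' - s) • η = 0 := by
    have : framePoint O η ζ s' c - framePoint O η ζ s c = (s' - s) • η := by
      simp only [framePoint]; module
    rw [← this, hτ, sub_self]
  rcases smul_eq_zero.1 h0 with h1 | h1
  · linarith
  · rw [h1] at h; simp [cross] at h

/-- The values of the component `⟨w, η⟩` on an edge, as a function of the line in direction `η` that
crosses the edge. -/
lemma exists_edge_crossing (O : Plane) {η ζ : Plane} (h : cross η ζ ≠ 0) (p q : Plane)
    {w : Plane → Plane} (hw : Continuous w) :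
    ∃ J : ℝ → ENNReal, Measurable J ∧
      (∫⁻ c, J c ≤ ENNReal.ofReal (‖η‖ ^ 2 * |(cross η ζ)⁻¹|) *
        ∫⁻ x in hull {p, q}, ‖w x‖ₑ ∂(Measure.hausdorffMeasure 1)) ∧
      ∀ s c, c ≠ level O η ζ p → framePoint O η ζ s c ∈ hull {p, q} →
        ‖inner ℝ (w (framePoint O η ζ s c)) η‖ₑ ≤ J c := by
  have hm : Continuous (AffineMap.lineMap p q : ℝ → Plane) := AffineMap.lineMap_continuous
  by_cases hδ : level O η ζ q - level O η ζ p = 0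
  · refine ⟨0, measurable_zero, by simp, fun s c hc hx => ?_⟩
    obtain ⟨τ, -, hτ⟩ := exists_lineMap_of_mem_hull hx
    have e1 := level_lineMap O η ζ p q τ
    rw [hτ, level_framePoint O h, hδ, mul_zero, add_zero] at e1
    exact absurd e1 hc
  set δ := level O η ζ q - level O η ζ p with hδd
  set F : ℝ → ENNReal := (Icc (0 : ℝ) 1).indicator fun τ =>
    ‖inner ℝ (w (AffineMap.lineMap p q τ)) η‖ₑ with hF
  have hFm : Measurable F := by
    refine Measurable.indicator ?_ measurableSet_Icc
    have : Continuous fun τ : ℝ => inner ℝ (w (AffineMap.lineMap p q τ)) η :=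
      (hw.comp hm).inner continuous_const
    exact this.measurable.enorm
  refine ⟨fun c => F (-(level O η ζ p) / δ + δ⁻¹ * c), by fun_prop, ?_, ?_⟩
  · have h1 := setLIntegral_comp_affine_le (g := F) δ⁻¹ (-(level O η ζ p) / δ) (inv_ne_zero hδ)
      univ univ MeasurableSet.univ MeasurableSet.univ fun _ _ => mem_univ _
    rw [Measure.restrict_univ, inv_inv] at h1
    refine h1.trans ?_
    rw [setLIntegral_hull_pair p q (hw.measurable.enorm)]
    have h2 : ∫⁻ τ, F τ ≤ ENNReal.ofReal ‖η‖ *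
        ∫⁻ τ in Icc (0 : ℝ) 1, ‖w (AffineMap.lineMap p q τ)‖ₑ := by
      rw [hF, lintegral_indicator measurableSet_Icc,
        ← lintegral_const_mul _ (f := fun τ => ‖w (AffineMap.lineMap p q τ)‖ₑ)
          (hw.comp hm).measurable.enorm]
      refine lintegral_mono fun τ => ?_
      rw [← ofReal_norm, ← ofReal_norm, ← ENNReal.ofReal_mul (norm_nonneg _),
        mul_comm]
      exact ENNReal.ofReal_le_ofReal (norm_inner_le_norm _ _)
    have h3 : |δ| * ‖η‖ ≤ ‖η‖ ^ 2 * |(cross η ζ)⁻¹| * dist p q := by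
      have : δ = cross η (q - p) / cross η ζ := by
        rw [hδd, level, level, ← sub_div]; congr 1; simp [cross]; ring
      rw [this, abs_div, abs_inv, div_eq_mul_inv, dist_comm, dist_eq_norm]
      have := abs_cross_le η (q - p)
      have h4 : 0 ≤ |cross η ζ|⁻¹ := by positivity
      calc |cross η (q - p)| * |cross η ζ|⁻¹ * ‖η‖ ≤ (‖η‖ * ‖q - p‖) * |cross η ζ|⁻¹ * ‖η‖ := by
            gcongr
        _ = _ := by ring
    calc ENNReal.ofReal |δ| * ∫⁻ τ, F τ ≤ ENNReal.ofReal |δ| * (ENNReal.ofReal ‖η‖ *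
          ∫⁻ τ in Icc (0 : ℝ) 1, ‖w (AffineMap.lineMap p q τ)‖ₑ) := by gcongr
      _ = ENNReal.ofReal (|δ| * ‖η‖) * ∫⁻ τ in Icc (0 : ℝ) 1, ‖w (AffineMap.lineMap p q τ)‖ₑ := by
          rw [ENNReal.ofReal_mul (abs_nonneg _), mul_assoc]
      _ ≤ ENNReal.ofReal (‖η‖ ^ 2 * |(cross η ζ)⁻¹| * dist p q) *
          ∫⁻ τ in Icc (0 : ℝ) 1, ‖w (AffineMap.lineMap p q τ)‖ₑ := by gcongr
      _ = _ := by rw [ENNReal.ofReal_mul (by positivity), mul_assoc]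
  · intro s c hc hx
    obtain ⟨τ, hτ01, hτ⟩ := exists_lineMap_of_mem_hull hx
    have e1 := level_lineMap O η ζ p q τ
    rw [hτ, level_framePoint O h, ← hδd] at e1
    have e2 : -(level O η ζ p) / δ + δ⁻¹ * c = τ := by
      rw [e1]; field_simp; ring
    simp only
    rw [e2, hF, indicator_of_mem hτ01, hτ]

/-! ### Oscillation of broken fields along lines -/

lemma hasDerivAt_inner_framePoint {w : Plane → Plane} (hw : ContDiff ℝ 2 w) (O η ζ : Plane)
    (c s : ℝ) : HasDerivAt (fun s => inner ℝ (w (framePoint O η ζ s c)) η)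
      (inner ℝ (fderiv ℝ w (framePoint O η ζ s c) η) η) s := by
  have h1 : HasDerivAt (fun s : ℝ => framePoint O η ζ s c) η s := by
    have := (((hasDerivAt_id s).smul_const η).const_add O).add_const (c • ζ)
    simpa [framePoint] using this
  have h2 := ((hw.differentiable (by norm_num)) (framePoint O η ζ s c)).hasFDerivAt.comp_hasDerivAt
    s h1
  simpa using h2.inner ℝ (hasDerivAt_const s η)

namespace Triangulation

variable {Ω : Set Plane} {𝒯H 𝒯h : Triangulation Ω}

/-- The total strain of a broken field on the triangle `T` (the sum of the `L¹` norms of the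
symmetric gradients and of the jumps), with values in `[0, ∞]`. -/
def totalStrain (𝒯h : Triangulation Ω) (T : Finset Plane) (v : Plane → Plane) : ENNReal :=
  (∑ t ∈ 𝒯h.trianglesIn T, ∫⁻ x in hull t, ENNReal.ofReal (strainNorm (piece v t) x)) +
    ∑ e ∈ 𝒯h.interiorEdgesIn T, ∫⁻ x in hull e, ‖jump 𝒯h v e x‖ₑ ∂(Measure.hausdorffMeasure 1)

/-- The directional component `⟨v, η⟩` of a broken field varies along a line in direction `η` by at
most the strain and the jumps met on that line. On the finitely many lines through a vertex of
the triangulation the bound `A` is infinite. -/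
lemma exists_line_oscillation (href : 𝒯H.IsRefinement 𝒯h) {T : Finset Plane}
    (hT : T ∈ 𝒯H.triangles) (v : Plane → Plane) {V : Plane → Plane}
    (hV : ∀ x ∈ interior (hull T), ∃ t ∈ 𝒯h.trianglesIn T, x ∈ hull t ∧ V x = piece v t x)
    (O : Plane) {η ζ : Plane} (h : cross η ζ ≠ 0) :
    ∃ A : ℝ → ENNReal, Measurable A ∧
      (∫⁻ c, A c ≤ ENNReal.ofReal (‖η‖ ^ 2 * |(cross η ζ)⁻¹|) * totalStrain 𝒯h T v) ∧
      ∀ s s' c, framePoint O η ζ s c ∈ interior (hull T) →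
        framePoint O η ζ s' c ∈ interior (hull T) →
        ‖inner ℝ (V (framePoint O η ζ s c)) η - inner ℝ (V (framePoint O η ζ s' c)) η‖ₑ ≤ A c := by
  -- `J e c` bounds the jump where the line of level `c` crosses the edge `e`.
  have edge : ∀ e : Finset Plane, ∃ J : ℝ → ENNReal, Measurable J ∧
      (e.card = 2 → ∫⁻ c, J c ≤ ENNReal.ofReal (‖η‖ ^ 2 * |(cross η ζ)⁻¹|) *
        ∫⁻ x in hull e, ‖jump 𝒯h v e x‖ₑ ∂(Measure.hausdorffMeasure 1)) ∧
      ∀ s c, e.card = 2 → (∀ p ∈ e, c ≠ level O η ζ p) → framePoint O η ζ s c ∈ hull e →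
        ‖inner ℝ (jump 𝒯h v e (framePoint O η ζ s c)) η‖ₑ ≤ J c := by
    intro e
    by_cases he : e.card = 2
    · obtain ⟨p, q, -, rfl⟩ := Finset.card_eq_two.1 he
      obtain ⟨J, h1, h2, h3⟩ := exists_edge_crossing O h p q (continuous_jump 𝒯h v {p, q})
      exact ⟨J, h1, fun _ => h2, fun s c _ hc hx => h3 s c (hc p (by simp)) hx⟩
    · exact ⟨0, measurable_zero, fun h => absurd h he, fun _ _ h => absurd h he⟩
  choose J hJm hJi hJ using edge
  have cardE : ∀ e ∈ 𝒯h.interiorEdgesIn T, e.card = 2 := by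
    intro e he
    obtain ⟨t, -, het⟩ := exists_mem_trianglesIn_of_edge href hT he
    exact (Finset.mem_powersetCard.1 het).2
  set G : Plane → ENNReal := fun x => ∑ t ∈ 𝒯h.trianglesIn T,
    (hull t).indicator (fun x => ENNReal.ofReal (‖η‖ ^ 2 * strainNorm (piece v t) x)) x with hG
  have hm1 : ∀ t, Measurable fun x => ENNReal.ofReal (‖η‖ ^ 2 * strainNorm (piece v t) x) :=
    fun t => (((continuous_strainNorm (contDiff_piece v t)).measurable.const_mul _).ennreal_ofReal)
  have hGm : Measurable G := by
    refine Finset.measurable_sum _ fun t _ => (hm1 t).indicator (measurableSet_hull t)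
  have hGf : Measurable fun p : ℝ × ℝ => G (framePoint O η ζ p.1 p.2) :=
    hGm.comp (continuous_framePoint O η ζ).measurable
  set bad : Finset ℝ := (𝒯h.triangles.biUnion id).image (level O η ζ) with hbad
  refine ⟨fun c => (∫⁻ s, G (framePoint O η ζ s c)) + (∑ e ∈ 𝒯h.interiorEdgesIn T, J e c) +
    (bad : Set ℝ).indicator (fun _ => ⊤) c, ?_, ?_, ?_⟩
  · refine Measurable.add (Measurable.add hGf.lintegral_prod_left' ?_) ?_
    · exact Finset.measurable_sum _ fun e _ => hJm e
    · exact measurable_const.indicator bad.measurableSet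
  · rw [lintegral_add_right _ (measurable_const.indicator bad.measurableSet),
      lintegral_add_left hGf.lintegral_prod_left', lintegral_indicator bad.measurableSet,
      setLIntegral_const, bad.finite_toSet.measure_zero, mul_zero, add_zero,
      lintegral_finsetSum _ fun e _ => hJm e,
      ← lintegral_prod_symm (μ := volume) (ν := volume)
        (fun p : ℝ × ℝ => G (framePoint O η ζ p.1 p.2))
        hGf.aemeasurable, ← Measure.volume_eq_prod, lintegral_framePoint O h hGm, totalStrain,
      mul_add, Finset.mul_sum, Finset.mul_sum]
    refine add_le_add (le_of_eq ?_) (Finset.sum_le_sum fun e he => hJi e (cardE e he))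
    rw [hG, lintegral_finsetSum _ fun t _ => (hm1 t).indicator (measurableSet_hull t),
      Finset.mul_sum]
    refine Finset.sum_congr rfl fun t _ => ?_
    rw [lintegral_indicator (measurableSet_hull t)]
    simp only [ENNReal.ofReal_mul (sq_nonneg ‖η‖)]
    rw [lintegral_const_mul _
      ((continuous_strainNorm (contDiff_piece v t)).measurable.ennreal_ofReal), ← mul_assoc,
      mul_comm (ENNReal.ofReal |_|)]
  · intro s s' c hs hs'
    by_cases hcb : c ∈ bad
    · simp only
      rw [indicator_of_mem (by exact_mod_cast hcb)]; simp
    refine le_trans ?_ le_self_add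
    have hlev : ∀ t ∈ 𝒯h.triangles, ∀ p ∈ t, c ≠ level O η ζ p := by
      rintro t ht p hp rfl
      exact hcb (Finset.mem_image_of_mem _ (Finset.mem_biUnion.2 ⟨t, ht, hp⟩))
    wlog hss : s ≤ s' generalizing s s'
    · rw [enorm_sub_rev]; exact this s' s hs' hs (le_of_not_ge hss)
    obtain ⟨i, hi, hsi, hVi⟩ := hV _ hs
    obtain ⟨j, hj, hsj, hVj⟩ := hV _ hs'
    rw [hVi, hVj]
    have hline : ∀ r ∈ Icc s s', framePoint O η ζ r c ∈ interior (hull T) := by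
      intro r hr
      have hc : Convex ℝ {r : ℝ | framePoint O η ζ r c ∈ interior (hull T)} := by
        have : {r : ℝ | framePoint O η ζ r c ∈ interior (hull T)} =
            (AffineMap.lineMap (framePoint O η ζ 0 c) (framePoint O η ζ 1 c)) ⁻¹'
              interior (hull T) := by
          ext r
          rw [mem_ofPred_eq, mem_preimage]
          have : (AffineMap.lineMap (framePoint O η ζ 0 c) (framePoint O η ζ 1 c)) r =
              framePoint O η ζ r c := by
            simp only [AffineMap.lineMap_apply_module, framePoint]; module
          rw [this]
        rw [this]
        exact (convex_hull T).interior.affine_preimage _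
      exact hc.ordConnected.out hs hs' hr
    have hcf : Continuous fun r : ℝ => framePoint O η ζ r c := by unfold framePoint; fun_prop
    have hσ : ∀ e : Finset Plane, ∃ σ : ℝ, e.card = 2 → (∀ p ∈ e, c ≠ level O η ζ p) →
        ∀ r, framePoint O η ζ r c ∈ hull e → σ = r := by
      intro e
      by_cases hex : e.card = 2 ∧ (∀ p ∈ e, c ≠ level O η ζ p) ∧ ∃ r, framePoint O η ζ r c ∈ hull e
      · obtain ⟨h1, h2, r, hr⟩ := hex
        refine ⟨r, fun _ _ r' hr' => ?_⟩
        obtain ⟨p, q, -, rfl⟩ := Finset.card_eq_two.1 h1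
        exact eq_of_mem_hull_pair O h (h2 p (by simp)) hr hr'
      · exact ⟨0, fun h1 h2 r hr => absurd ⟨h1, h2, r, hr⟩ hex⟩
    choose σ hσ using hσ
    refine piecewise_variation (K := 𝒯h.trianglesIn T)
      (I := fun t => {r | framePoint O η ζ r c ∈ hull t})
      (f := fun t r => inner ℝ (piece v t (framePoint O η ζ r c)) η)
      (f' := fun t r => inner ℝ (fderiv ℝ (piece v t) (framePoint O η ζ r c) η) η)
      (𝓔 := 𝒯h.interiorEdgesIn T) (σ := σ) (N := fun e => J e c)
      (fun t _ => (isClosed_hull t).preimage hcf) (fun t _ => ?_)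
      (fun t _ r => hasDerivAt_inner_framePoint (contDiff_piece v t) O η ζ c r)
      (fun t _ => ?_) (fun t ht r hr => ?_) hss hi hsi hj hsj ?_ ?_
    · have : {r : ℝ | framePoint O η ζ r c ∈ hull t} =
            (AffineMap.lineMap (framePoint O η ζ 0 c) (framePoint O η ζ 1 c)) ⁻¹' hull t := by
        ext r
        rw [mem_ofPred_eq, mem_preimage]
        have : (AffineMap.lineMap (framePoint O η ζ 0 c) (framePoint O η ζ 1 c)) r =
            framePoint O η ζ r c := by
          simp only [AffineMap.lineMap_apply_module, framePoint]; module
        rw [this]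
      rw [this]
      exact ((convex_hull t).affine_preimage _).ordConnected
    · have := (contDiff_piece v t).continuous_fderiv (by norm_num)
      exact ((this.comp hcf).clm_apply continuous_const).inner continuous_const
    · refine le_trans ?_ (Finset.single_le_sum (f := fun t => (hull t).indicator
        (fun x => ENNReal.ofReal (‖η‖ ^ 2 * strainNorm (piece v t) x)) (framePoint O η ζ r c))
        (fun _ _ => zero_le) ht)
      rw [indicator_of_mem (show framePoint O η ζ r c ∈ hull t from hr), ← ofReal_norm,
        Real.norm_eq_abs]
      exact ENNReal.ofReal_le_ofReal (abs_inner_fderiv_le _ _ _)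
    · intro t₁ h₁ t₂ h₂ hne r hr x₁ x₂
      have m₁ := (Finset.mem_filter.1 h₁).1
      have m₂ := (Finset.mem_filter.1 h₂).1
      have hnv : framePoint O η ζ r c ∉ t₁ := fun hmem =>
        hlev t₁ m₁ _ hmem (level_framePoint O h r c).symm
      obtain ⟨hcard, hmemE, hxe⟩ := inter_mem_interiorEdgesIn h₁ h₂ hne (hline r hr) x₁ x₂ hnv
      have hle : ∀ p ∈ t₁ ∩ t₂, c ≠ level O η ζ p := fun p hp =>
        hlev t₁ m₁ p (Finset.mem_inter.1 hp).1
      refine ⟨t₁ ∩ t₂, hmemE, hσ _ hcard hle r hxe, ?_⟩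
      refine le_trans (le_of_eq ?_) (hJ _ r c hcard hle hxe)
      rcases jump_eq_or m₁ m₂ hne hcard Finset.inter_subset_left Finset.inter_subset_right v with
        hj | hj
      · rw [hj, Pi.sub_apply, inner_sub_left]
      · rw [hj, Pi.sub_apply, inner_sub_left, enorm_sub_rev]
    · intro r hr
      exact exists_mem_trianglesIn href hT (hline r hr)

end Triangulation

/-! ### The total strain and the broken energy -/

/-- Optimizing Young's inequality over its parameter; the best `l` is `m / a`. -/
lemma sq_le_mul_of_forall_le {m a R : ℝ} (ha : 0 < a) (hm : 0 ≤ m) (hR : 0 ≤ R)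
    (h : ∀ l : ℝ, 0 < l → m ≤ (l * a + R / l) / 2) : m ^ 2 ≤ a * R := by
  rcases hm.eq_or_lt with rfl | hm
  · simpa using by positivity
  · have := h (m / a) (by positivity)
    have e1 : m / a * a = m := by field_simp
    have e2 : R / (m / a) = a * R / m := by field_simp
    rw [e1, e2] at this
    have : m ≤ a * R / m := by linarith
    rw [le_div_iff₀ hm] at this
    rwa [sq]

lemma le_amgm (x : ℝ) {l : ℝ} (hl : 0 < l) : x ≤ (l + x ^ 2 / l) / 2 := by
  have : (l + x ^ 2 / l) / 2 - x = (l - x) ^ 2 / (2 * l) := by field_simp; ring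
  have h2 : 0 ≤ (l - x) ^ 2 / (2 * l) := by positivity
  linarith

lemma strainSq_nonneg (v : Plane → Plane) (t : Finset Plane) : 0 ≤ strainSq v t :=
  integral_nonneg fun x => by positivity

lemma jumpSq_nonneg {Ω : Set Plane} (𝒯 : Triangulation Ω) (v : Plane → Plane) (e : Finset Plane) :
    0 ≤ jumpSq 𝒯 v e := integral_nonneg fun x => by positivity

/-- Young's inequality, integrated over a set of finite measure. -/
lemma setLIntegral_le_amgm {μ : Measure Plane} {K : Set Plane} (hK : IsCompact K)
    (hμ : μ K ≠ ⊤) {f : Plane → ℝ} (hf : Continuous f) {l : ℝ} (hl : 0 < l) :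
    ∫⁻ x in K, ENNReal.ofReal (f x) ∂μ ≤
      ENNReal.ofReal ((l * μ.real K + (∫ x in K, f x ^ 2 ∂μ) / l) / 2) := by
  have hfin : IsFiniteMeasure (μ.restrict K) := ⟨by
    rw [Measure.restrict_apply_univ]; exact hμ.lt_top⟩
  have hint : ∀ g : Plane → ℝ, Continuous g → Integrable g (μ.restrict K) := by
    intro g hg
    obtain ⟨C, hC⟩ := hK.exists_bound_of_continuousOn hg.continuousOn
    exact Measure.integrableOn_of_bounded (M := C) hμ hg.aestronglyMeasurable
      ((ae_restrict_iff' hK.measurableSet).2 (Filter.Eventually.of_forall hC))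
  calc ∫⁻ x in K, ENNReal.ofReal (f x) ∂μ
      ≤ ∫⁻ x in K, ENNReal.ofReal ((l + f x ^ 2 / l) / 2) ∂μ :=
        lintegral_mono fun x => ENNReal.ofReal_le_ofReal (le_amgm _ hl)
    _ = ENNReal.ofReal (∫ x in K, (l + f x ^ 2 / l) / 2 ∂μ) := by
        rw [ofReal_integral_eq_lintegral_ofReal (hint _ (by fun_prop))]
        exact Filter.Eventually.of_forall fun x => by positivity
    _ = _ := by
        congr 1
        rw [integral_div, integral_add (integrable_const _) ((hint _ (by fun_prop)).div_const _),
          integral_div, integral_const, measureReal_restrict_apply_univ, smul_eq_mul, mul_comm l]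

namespace Triangulation

variable {Ω : Set Plane} {𝒯H 𝒯h : Triangulation Ω}

lemma volume_real_hull_pos (𝒯 : Triangulation Ω) {T : Finset Plane} (hT : T ∈ 𝒯.triangles) :
    0 < volume.real (hull T) := by
  have h1 := (volume_real_hull_bounds (𝒯.toSimplex T hT)).2
  rw [← hull_eq_toSimplex] at h1
  have h2 := abs_pos.2 (cross_ne_zero (𝒯.toSimplex T hT))
  linarith

/-- The strain and jump terms of Korn's inequality. -/
def brokenEnergy (𝒯h : Triangulation Ω) (T : Finset Plane) (v : Plane → Plane) : ℝ :=
  ∑ t ∈ 𝒯h.trianglesIn T, strainSq v t +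
    ∑ e ∈ 𝒯h.interiorEdgesIn T, (edgeLength e)⁻¹ * jumpSq 𝒯h v e

lemma brokenEnergy_nonneg (𝒯h : Triangulation Ω) (T : Finset Plane) (v : Plane → Plane) :
    0 ≤ brokenEnergy 𝒯h T v :=
  add_nonneg (Finset.sum_nonneg fun _ _ => strainSq_nonneg _ _) (Finset.sum_nonneg fun _ _ =>
    mul_nonneg (inv_nonneg.2 Metric.diam_nonneg) (jumpSq_nonneg _ _ _))

lemma totalStrain_le_amgm {γ₀ : ℝ} (h : 𝒯h.ShapeRegular γ₀) (href : 𝒯H.IsRefinement 𝒯h)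
    {T : Finset Plane} (hT : T ∈ 𝒯H.triangles) (v : Plane → Plane) {l : ℝ} (hl : 0 < l) :
    totalStrain 𝒯h T v ≤ ENNReal.ofReal
      ((l * ((1 + 48 * γ₀ ^ 2) * volume.real (hull T)) + brokenEnergy 𝒯h T v / l) / 2) := by
  have h1 : ∀ t ∈ 𝒯h.trianglesIn T, ∫⁻ x in hull t, ENNReal.ofReal (strainNorm (piece v t) x) ≤
      ENNReal.ofReal ((l * volume.real (hull t) + strainSq v t / l) / 2) := by
    intro t _
    refine (setLIntegral_le_amgm (isCompact_hull t) (volume_hull_ne_top t)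
      (continuous_strainNorm (contDiff_piece v t)) hl).trans (le_of_eq ?_)
    simp only [strainNorm_sq]; rfl
  have h2 : ∀ e ∈ 𝒯h.interiorEdgesIn T,
      ∫⁻ x in hull e, ‖jump 𝒯h v e x‖ₑ ∂(Measure.hausdorffMeasure 1) ≤
      ENNReal.ofReal ((l * edgeLength e ^ 2 + ((edgeLength e)⁻¹ * jumpSq 𝒯h v e) / l) / 2) := by
    intro e he
    obtain ⟨t, -, het⟩ := exists_mem_trianglesIn_of_edge href hT he
    obtain ⟨p, q, hpq, rfl⟩ := Finset.card_eq_two.1 (Finset.mem_powersetCard.1 het).2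
    have hH : (Measure.hausdorffMeasure 1 : Measure Plane) (hull {p, q}) = edist p q := by
      rw [hull, Finset.coe_pair, convexHull_pair, hausdorffMeasure_segment]
    have hd : 0 < dist p q := dist_pos.2 hpq
    simp only [← ofReal_norm]
    refine (setLIntegral_le_amgm (isCompact_hull _) (by rw [hH]; exact edist_ne_top _ _)
      (continuous_jump 𝒯h v _).norm (l := l * dist p q) (by positivity)).trans (le_of_eq ?_)
    rw [measureReal_def, hH, edist_dist, ENNReal.toReal_ofReal dist_nonneg, edgeLength_pair]
    change ENNReal.ofReal ((_ + jumpSq 𝒯h v {p, q} / _) / 2) = _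
    congr 1
    field_simp
  refine (add_le_add (Finset.sum_le_sum h1) (Finset.sum_le_sum h2)).trans ?_
  have n1 : ∀ t, 0 ≤ (l * volume.real (hull t) + strainSq v t / l) / 2 := fun t => by
    have := strainSq_nonneg v t; positivity
  have n2 : ∀ e, 0 ≤ (l * edgeLength e ^ 2 + ((edgeLength e)⁻¹ * jumpSq 𝒯h v e) / l) / 2 :=
    fun e => by
      have := jumpSq_nonneg 𝒯h v e
      have : 0 ≤ edgeLength e := Metric.diam_nonneg
      positivity
  rw [← ENNReal.ofReal_sum_of_nonneg fun t _ => n1 t,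
    ← ENNReal.ofReal_sum_of_nonneg fun e _ => n2 e,
    ← ENNReal.ofReal_add (Finset.sum_nonneg fun t _ => n1 t) (Finset.sum_nonneg fun e _ => n2 e)]
  refine ENNReal.ofReal_le_ofReal ?_
  rw [← Finset.sum_div, ← Finset.sum_div, Finset.sum_add_distrib, Finset.sum_add_distrib,
    ← Finset.mul_sum, ← Finset.mul_sum, ← Finset.sum_div, ← Finset.sum_div, brokenEnergy]
  have b1 := mul_le_mul_of_nonneg_left (sum_volume_trianglesIn_le (𝒯h := 𝒯h) T) hl.le
  have b2 := mul_le_mul_of_nonneg_left (sum_edgeLength_sq_le h href hT) hl.le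
  rw [add_div _ _ l]
  linarith

/-- The Cauchy-Schwarz bound for the total strain. -/
lemma totalStrain_sq_le {γ₀ : ℝ} (h : 𝒯h.ShapeRegular γ₀) (href : 𝒯H.IsRefinement 𝒯h)
    {T : Finset Plane} (hT : T ∈ 𝒯H.triangles) (v : Plane → Plane) :
    totalStrain 𝒯h T v ^ 2 ≤ ENNReal.ofReal
      ((1 + 48 * γ₀ ^ 2) * volume.real (hull T) * brokenEnergy 𝒯h T v) := by
  have hv := volume_real_hull_pos 𝒯H hT
  have hfin : totalStrain 𝒯h T v ≠ ⊤ :=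
    ((totalStrain_le_amgm h href hT v one_pos).trans_lt ENNReal.ofReal_lt_top).ne
  rw [← ENNReal.ofReal_toReal hfin, ← ENNReal.ofReal_pow ENNReal.toReal_nonneg]
  refine ENNReal.ofReal_le_ofReal (sq_le_mul_of_forall_le (by positivity) ENNReal.toReal_nonneg
    (brokenEnergy_nonneg _ _ _) fun l hl => ?_)
  have hk := brokenEnergy_nonneg 𝒯h T v
  exact ENNReal.toReal_le_of_le_ofReal (by positivity) (totalStrain_le_amgm h href hT v hl)

/-- Finitely many continuous fields on closed sets can be glued to one bounded measurable field. -/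
lemma exists_measurable_selection (K : Finset (Finset Plane)) {w : Finset Plane → Plane → Plane}
    (hw : ∀ t, Continuous (w t)) :
    ∃ V : Plane → Plane, Measurable V ∧ (∃ M : ℝ, ∀ x, ‖V x‖ ≤ M) ∧
      ∀ x, (∃ t ∈ K, x ∈ hull t) → ∃ t ∈ K, x ∈ hull t ∧ V x = w t x := by
  induction K using Finset.induction_on with
  | empty => exact ⟨0, measurable_zero, ⟨0, by simp⟩, by simp⟩
  | insert t K _ ih =>
    obtain ⟨V, hV, ⟨M, hM⟩, hsel⟩ := ih
    obtain ⟨C, hC⟩ := (isCompact_hull t).exists_bound_of_continuousOn (hw t).continuousOn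
    refine ⟨(hull t).piecewise (w t) V, (hw t).measurable.piecewise (measurableSet_hull t) hV,
      ⟨max C M, fun x => ?_⟩, ?_⟩
    · by_cases hx : x ∈ hull t
      · rw [piecewise_eq_of_mem _ _ _ hx]; exact (hC x hx).trans (le_max_left _ _)
      · rw [piecewise_eq_of_notMem _ _ _ hx]; exact (hM x).trans (le_max_right _ _)
    · rintro x ⟨t', ht', hxt'⟩
      by_cases hx : x ∈ hull t
      · exact ⟨t, Finset.mem_insert_self _ _, hx, piecewise_eq_of_mem _ _ _ hx⟩
      · rcases Finset.mem_insert.1 ht' with rfl | ht'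
        · exact absurd hxt' hx
        · obtain ⟨s, hs, hxs, hVs⟩ := hsel x ⟨t', ht', hxt'⟩
          exact ⟨s, Finset.mem_insert_of_mem hs, hxs, by
            rw [piecewise_eq_of_notMem _ _ _ hx, hVs]⟩

lemma ae_eq_of_selection (href : 𝒯H.IsRefinement 𝒯h) {T : Finset Plane}
    (hT : T ∈ 𝒯H.triangles) {v V : Plane → Plane}
    (hv : ∀ t ∈ 𝒯h.trianglesIn T, ∃ p, AgreesOn v t p)
    (hV : ∀ x, (∃ t ∈ 𝒯h.trianglesIn T, x ∈ hull t) →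
      ∃ t ∈ 𝒯h.trianglesIn T, x ∈ hull t ∧ V x = piece v t x) :
    v =ᵐ[volume.restrict (hull T)] V := by
  have h1 : ∀ t ∈ 𝒯h.trianglesIn T, ∀ᵐ x, x ∈ hull t → v x = piece v t x := by
    intro t ht
    have hex := hv t ht
    rw [← ae_restrict_iff' (measurableSet_hull t)]
    rw [piece, dif_pos hex]
    exact hex.choose_spec
  have h2 : ∀ᵐ x, ∀ t ∈ 𝒯h.trianglesIn T, x ∈ hull t → v x = piece v t x :=
    (Finset.eventually_all _).2 h1
  have h3 : volume.restrict (hull T) = volume.restrict (interior (hull T)) :=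
    (Measure.restrict_congr_set
      (interior_ae_eq_of_null_frontier ((convex_hull T).addHaar_frontier volume))).symm
  rw [h3]
  refine (ae_restrict_iff' isOpen_interior.measurableSet).2 ?_
  filter_upwards [h2] with x hx hxT
  obtain ⟨t, ht, hxt, hVt⟩ := hV x (exists_mem_trianglesIn href hT hxT)
  rw [hVt, hx t ht hxt]

end Triangulation

/-! ### Korn's inequality for broken fields -/

/-- A vector is controlled by its components along two vectors spanning the plane. -/
lemma norm_sq_mul_cross_sq_le (z ξ₁ ξ₂ : Plane) :
    ‖z‖ ^ 2 * cross ξ₁ ξ₂ ^ 2 ≤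
      2 * (‖ξ₂‖ ^ 2 * inner ℝ z ξ₁ ^ 2 + ‖ξ₁‖ ^ 2 * inner ℝ z ξ₂ ^ 2) := by
  rw [plane_norm_sq, plane_norm_sq, plane_norm_sq, plane_inner, plane_inner, cross]
  generalize z 0 = a
  generalize z 1 = b
  generalize ξ₁ 0 = c
  generalize ξ₁ 1 = d
  generalize ξ₂ 0 = e
  generalize ξ₂ 1 = f
  have h0 : a * (c * f - d * e) = (a * c + b * d) * f - (a * e + b * f) * d := by ring
  have h1 : b * (c * f - d * e) = (a * e + b * f) * c - (a * c + b * d) * e := by ring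
  generalize a * c + b * d = U at *
  generalize a * e + b * f = W at *
  have e1 : (a ^ 2 + b ^ 2) * (c * f - d * e) ^ 2 = (U * f - W * d) ^ 2 + (W * c - U * e) ^ 2 := by
    rw [← h0, ← h1]; ring
  rw [e1]
  nlinarith [sq_nonneg (U * f + W * d), sq_nonneg (W * c + U * e)]

/-- A rigid motion with prescribed components along two vectors in the coordinates of the frame they
span. -/
lemma exists_rigidMotion (O : Plane) {ξ₁ ξ₂ : Plane} (h : cross ξ₁ ξ₂ ≠ 0) (c₁ c₂ c₃ : ℝ) :
    ∃ m ∈ rigidMotions, Continuous m ∧ ∀ s c,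
      inner ℝ (m (framePoint O ξ₁ ξ₂ s c)) ξ₁ = c₁ - c₃ * c ∧
      inner ℝ (m (framePoint O ξ₁ ξ₂ s c)) ξ₂ = c₂ + c₃ * s := by
  set d := cross ξ₁ ξ₂ with hd
  set b := c₃ / d with hb
  set a₁ := (c₁ * ξ₂ 1 - c₂ * ξ₁ 1) / d + b * O 1 with ha₁
  set a₂ := (-c₁ * ξ₂ 0 + c₂ * ξ₁ 0) / d - b * O 0 with ha₂
  refine ⟨fun x => !₂[a₁ - b * x 1, a₂ + b * x 0], ⟨a₁, a₂, b, fun x => rfl⟩, ?_, fun s c => ?_⟩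
  · refine (PiLp.continuous_toLp 2 _).comp (continuous_pi fun i => ?_)
    fin_cases i <;> simp <;> fun_prop
  · have hd' : ξ₁ 0 * ξ₂ 1 - ξ₁ 1 * ξ₂ 0 = d := rfl
    rw [plane_inner, plane_inner]
    simp only [framePoint, ha₁, ha₂, hb]
    constructor
    · simp
      field_simp
      rw [← hd']; ring
    · simp
      field_simp
      rw [← hd']; ring

namespace Triangulation

variable {Ω : Set Plane} {𝒯H 𝒯h : Triangulation Ω}

/-- Korn's inequality for a broken field in terms of its total strain. The constant is
`8 * 5000000 * 12 ^ 2`, where `12` counts `4` for each of the three edge directions. -/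
lemma exists_rigidMotion_lintegral_le {γ₀ : ℝ} (hH : 𝒯H.ShapeRegular γ₀)
    (href : 𝒯H.IsRefinement 𝒯h) {T : Finset Plane}
    (hT : T ∈ 𝒯H.triangles) (v : Plane → Plane) {V : Plane → Plane} (hVm : Measurable V) {M : ℝ}
    (hM : ∀ x, ‖V x‖ ≤ M)
    (hV : ∀ x ∈ interior (hull T), ∃ t ∈ 𝒯h.trianglesIn T, x ∈ hull t ∧ V x = piece v t x) :
    ∃ m ∈ rigidMotions, Continuous m ∧ ∫⁻ x in hull T, ‖V x - m x‖ₑ ^ 2 ≤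
      ENNReal.ofReal (5760000000 * γ₀ ^ 6) * totalStrain 𝒯h T v ^ 2 := by
  set S := 𝒯H.toSimplex T hT with hS
  have hcr := cross_ne_zero S
  have hTS : hull T = convexHull ℝ (range S.points) := 𝒯H.hull_eq_toSimplex hT
  have dist01 := dist_sq_le_of_shapeRegular S (hH T hT) 1 0
  have dist02 := dist_sq_le_of_shapeRegular S (hH T hT) 2 0
  have dist12 := dist_sq_le_of_shapeRegular S (hH T hT) 1 2
  have hint := fun (s c : ℝ) => framePoint_mem_interior_iff S (s := s) (c := c)
  rw [← hTS] at hint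
  have hsub12 : S.points 1 - S.points 2 =
      (S.points 1 - S.points 0) - (S.points 2 - S.points 0) := by
    abel
  rw [dist_eq_norm] at dist01 dist02 dist12
  rw [hsub12] at dist12
  have hlin := fun {G : Plane → ENNReal} (hG : Measurable G) => setLIntegral_unitSimplex S hG
  rw [← hTS] at hlin
  set O := S.points 0
  set ξ₁ := S.points 1 - O with hξ₁
  set ξ₂ := S.points 2 - O with hξ₂
  set d := cross ξ₁ ξ₂ with hd
  have c2 : cross ξ₂ ξ₁ = -d := by rw [hd]; simp [cross]; ring
  have c3 : cross (ξ₁ - ξ₂) ξ₂ = d := by rw [hd]; simp [cross]; ring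
  obtain ⟨A, hA, iA, oA⟩ := exists_line_oscillation href hT v hV O (η := ξ₁) (ζ := ξ₂) hcr
  obtain ⟨B, hB, iB, oB⟩ := exists_line_oscillation href hT v hV O (η := ξ₂) (ζ := ξ₁)
    (by rw [c2]; exact neg_ne_zero.2 hcr)
  obtain ⟨D, hD, iD, oD⟩ := exists_line_oscillation href hT v hV O (η := ξ₁ - ξ₂) (ζ := ξ₂)
    (by rw [c3]; exact hcr)
  have hdpos : 0 < |d| := abs_pos.2 hcr
  have bnd : ∀ {η : Plane} {d' : ℝ}, |d'| = |d| → ‖η‖ ^ 2 ≤ 4 * γ₀ ^ 2 * |d| →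
      ENNReal.ofReal (‖η‖ ^ 2 * |d'⁻¹|) ≤ ENNReal.ofReal (4 * γ₀ ^ 2) := by
    intro η d' h1 h2
    refine ENNReal.ofReal_le_ofReal ?_
    rw [abs_inv, h1, ← div_eq_mul_inv, div_le_iff₀ hdpos]
    exact h2
  have iA' := iA.trans (mul_le_mul_left (bnd rfl dist01) _)
  have iB' := iB.trans (mul_le_mul_left (bnd (by rw [c2, abs_neg]) dist02) _)
  have iD' := iD.trans (mul_le_mul_left (bnd (by rw [c3]) dist12) _)
  have hswap : ∀ x y, framePoint O ξ₂ ξ₁ y x = framePoint O ξ₁ ξ₂ x y := fun x y => by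
    simp only [framePoint]; module
  have hdiag : ∀ x y, framePoint O (ξ₁ - ξ₂) ξ₂ x (x + y) = framePoint O ξ₁ ξ₂ x y := fun x y => by
    simp only [framePoint]; module
  have hfm : Measurable fun p : ℝ × ℝ => framePoint O ξ₁ ξ₂ p.1 p.2 :=
    (continuous_framePoint O ξ₁ ξ₂).measurable
  have hcomp : ∀ ξ : Plane, Measurable fun p : ℝ × ℝ =>
      inner ℝ (V (framePoint O ξ₁ ξ₂ p.1 p.2)) ξ := fun ξ =>
    (hVm.comp hfm).inner measurable_const
  have hbd : ∀ (ξ : Plane) (p : ℝ × ℝ), ‖ξ‖ ≤ ‖ξ₁‖ + ‖ξ₂‖ →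
      |inner ℝ (V (framePoint O ξ₁ ξ₂ p.1 p.2)) ξ| ≤ M * (‖ξ₁‖ + ‖ξ₂‖) := fun ξ p hξ =>
    (abs_real_inner_le_norm _ _).trans (mul_le_mul (hM _) hξ (norm_nonneg _)
      ((norm_nonneg _).trans (hM 0)))
  obtain ⟨c₁, c₂, c₃, hK⟩ := korn_of_line_oscillation (hcomp ξ₁) (hcomp ξ₂)
    (fun p => hbd ξ₁ p (le_add_of_nonneg_right (norm_nonneg _)))
    (fun p => hbd ξ₂ p (le_add_of_nonneg_left (norm_nonneg _))) hA hB hD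
    (fun x x' y h h' => oA x x' y ((hint x y).2 h) ((hint x' y).2 h'))
    (fun x y y' h h' => by
      have := oB y y' x (by rw [hswap]; exact (hint x y).2 h)
        (by rw [hswap]; exact (hint x y').2 h')
      simpa only [hswap] using this)
    (fun x y x' y' h h' hs => by
      have := oD x x' (x + y) (by rw [hdiag]; exact (hint x y).2 h)
        (by rw [hs, hdiag]; exact (hint x' y').2 h')
      rw [hdiag, hs, hdiag, inner_sub_right _ ξ₁ ξ₂, inner_sub_right _ ξ₁ ξ₂, ← hs] at this
      exact this)
  obtain ⟨m, hm, hmc, hmi⟩ := exists_rigidMotion O hcr c₁ c₂ c₃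
  refine ⟨m, hm, hmc, ?_⟩
  have hG : Measurable fun x => ‖V x - m x‖ₑ ^ 2 := (hVm.sub hmc.measurable).enorm.pow_const 2
  have hE : ((∫⁻ x, A x) + (∫⁻ x, B x) + ∫⁻ x, D x) ≤
      ENNReal.ofReal (12 * γ₀ ^ 2) * totalStrain 𝒯h T v := by
    refine (add_le_add (add_le_add iA' iB') iD').trans (le_of_eq ?_)
    rw [← add_mul, ← add_mul, ← ENNReal.ofReal_add (by positivity) (by positivity),
      ← ENNReal.ofReal_add (by positivity) (by positivity)]
    congr 2; ring
  have pt : ∀ p ∈ unitSimplex,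
      ‖V (framePoint O ξ₁ ξ₂ p.1 p.2) - m (framePoint O ξ₁ ξ₂ p.1 p.2)‖ₑ ^ 2 ≤
      ENNReal.ofReal (8 * γ₀ ^ 2 * |d|⁻¹) *
        (‖inner ℝ (V (framePoint O ξ₁ ξ₂ p.1 p.2)) ξ₁ - (c₁ - c₃ * p.2)‖ₑ ^ 2 +
          ‖inner ℝ (V (framePoint O ξ₁ ξ₂ p.1 p.2)) ξ₂ - (c₂ + c₃ * p.1)‖ₑ ^ 2) := by
    intro p _
    obtain ⟨h1, h2⟩ := hmi p.1 p.2
    rw [← h1, ← h2, ← inner_sub_left, ← inner_sub_left]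
    generalize V (framePoint O ξ₁ ξ₂ p.1 p.2) - m (framePoint O ξ₁ ξ₂ p.1 p.2) = z
    rw [← ofReal_norm, ← ofReal_norm, ← ofReal_norm, ← ENNReal.ofReal_pow (norm_nonneg _),
      ← ENNReal.ofReal_pow (norm_nonneg _), ← ENNReal.ofReal_pow (norm_nonneg _),
      ← ENNReal.ofReal_add (by positivity) (by positivity), ← ENNReal.ofReal_mul (by positivity)]
    refine ENNReal.ofReal_le_ofReal ?_
    have h3 := norm_sq_mul_cross_sq_le z ξ₁ ξ₂
    rw [Real.norm_eq_abs, Real.norm_eq_abs, sq_abs, sq_abs]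
    rw [← hd, ← sq_abs d] at h3
    have h4 : ‖z‖ ^ 2 * |d| ^ 2 ≤ 2 * (4 * γ₀ ^ 2 * |d| * inner ℝ z ξ₁ ^ 2 +
        4 * γ₀ ^ 2 * |d| * inner ℝ z ξ₂ ^ 2) := by
      refine h3.trans ?_
      gcongr
    have h5 : 8 * γ₀ ^ 2 * |d|⁻¹ * (inner ℝ z ξ₁ ^ 2 + inner ℝ z ξ₂ ^ 2) =
        2 * (4 * γ₀ ^ 2 * |d| * inner ℝ z ξ₁ ^ 2 + 4 * γ₀ ^ 2 * |d| * inner ℝ z ξ₂ ^ 2) /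
          |d| ^ 2 := by
      field_simp; ring
    rw [h5, le_div_iff₀ (by positivity)]
    exact h4
  have hcv := hlin hG
  have hmul : ∫⁻ x in hull T, ‖V x - m x‖ₑ ^ 2 = ENNReal.ofReal |d| * ∫⁻ p in unitSimplex,
      ‖V (framePoint O ξ₁ ξ₂ p.1 p.2) - m (framePoint O ξ₁ ξ₂ p.1 p.2)‖ₑ ^ 2 := by
    rw [hcv, ← mul_assoc, ← ENNReal.ofReal_mul hdpos.le, abs_inv, mul_inv_cancel₀ hdpos.ne',
      ENNReal.ofReal_one, one_mul]
  rw [hmul]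
  have hc8 : 0 ≤ 8 * γ₀ ^ 2 * |d|⁻¹ := by positivity
  have m5 : (5000000 : ENNReal) = ENNReal.ofReal 5000000 := by simp
  calc _ ≤ ENNReal.ofReal |d| * ∫⁻ p in unitSimplex, ENNReal.ofReal (8 * γ₀ ^ 2 * |d|⁻¹) *
        (‖inner ℝ (V (framePoint O ξ₁ ξ₂ p.1 p.2)) ξ₁ - (c₁ - c₃ * p.2)‖ₑ ^ 2 +
          ‖inner ℝ (V (framePoint O ξ₁ ξ₂ p.1 p.2)) ξ₂ - (c₂ + c₃ * p.1)‖ₑ ^ 2) := by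
        exact mul_le_mul_right (setLIntegral_mono' measurableSet_unitSimplex pt) _
    _ ≤ ENNReal.ofReal |d| * (ENNReal.ofReal (8 * γ₀ ^ 2 * |d|⁻¹) *
          (5000000 * (ENNReal.ofReal (12 * γ₀ ^ 2) * totalStrain 𝒯h T v) ^ 2)) := by
        rw [lintegral_const_mul']
        · gcongr
          exact hK.trans (by gcongr)
        · exact ENNReal.ofReal_ne_top
    _ = ENNReal.ofReal (5760000000 * γ₀ ^ 6) * totalStrain 𝒯h T v ^ 2 := by
        rw [mul_pow, m5, ← ENNReal.ofReal_pow (by positivity), ← mul_assoc, ← mul_assoc,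
          ← mul_assoc, ← ENNReal.ofReal_mul (by positivity), ← ENNReal.ofReal_mul (by positivity),
          ← ENNReal.ofReal_mul (by positivity)]
        congr 2
        field_simp
        ring

end Triangulation

/-- The projection onto the rigid motions is the best approximation in `L²`. -/
lemma norm_sub_rigidProj_le {K : Set Plane} (v : L2 K) {m : Plane → Plane} (hm : m ∈ rigidMotions)
    (hmL : MemLp m 2 (volume.restrict K)) :
    ‖v - rigidProj K v‖ ≤ ‖v - MemLp.toLp m hmL‖ := by
  rw [rigidProj, Submodule.starProjection_minimal]
  exact ciInf_le ⟨0, by rintro _ ⟨x, rfl⟩; exact norm_nonneg _⟩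
    (⟨MemLp.toLp m hmL, m, hm, hmL.coeFn_toLp⟩ : rigidMotionsL2 K)

lemma norm_sq_le_of_lintegral_le {K : Set Plane} (f : L2 K) {c : ℝ} (hc : 0 ≤ c)
    (h : ∫⁻ x in K, ‖f x‖ₑ ^ 2 ≤ ENNReal.ofReal c) : ‖f‖ ^ 2 ≤ c := by
  have h1 := eLpNorm_nnreal_pow_eq_lintegral (f := f) (μ := volume.restrict K) (p := 2) two_ne_zero
  have h2 : ‖f‖ₑ ^ 2 = ∫⁻ x in K, ‖f x‖ₑ ^ 2 := by
    rw [Lp.enorm_def]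
    have e : ((2 : NNReal) : ℝ) = ((2 : ℕ) : ℝ) := by norm_num
    rw [e] at h1
    simp only [ENNReal.rpow_natCast] at h1
    exact h1
  rw [← h2, ← ofReal_norm, ← ENNReal.ofReal_pow (norm_nonneg _),
    ENNReal.ofReal_le_ofReal_iff hc] at h
  exact h

end DiscreteKorn

end

theorem lemma5p2 (γ₀ : ℝ) :
    ∃ C : ℝ, 0 < C ∧
      ∀ (Ω : Set DiscreteKorn.Plane) (𝒯H 𝒯h : DiscreteKorn.Triangulation Ω),
        𝒯H.ShapeRegular γ₀ → 𝒯h.ShapeRegular γ₀ → 𝒯H.IsRefinement 𝒯h →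
        ∀ (r : ℕ), ∀ T ∈ 𝒯H.triangles, ∀ v ∈ DiscreteKorn.brokenPoly 𝒯h r T,
          (DiscreteKorn.size T)⁻¹ ^ 2 * ‖v - DiscreteKorn.rigidProj (DiscreteKorn.hull T) v‖ ^ 2 ≤
            C * (∑ T' ∈ 𝒯h.trianglesIn T, DiscreteKorn.strainSq v T' +
              ∑ e ∈ 𝒯h.interiorEdgesIn T,
                (DiscreteKorn.edgeLength e)⁻¹ * DiscreteKorn.jumpSq 𝒯h v e) := by
  set C₀ : ℝ := 5760000000 * γ₀ ^ 6 * (1 + 48 * γ₀ ^ 2) with hC₀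
  have hC₀n : 0 ≤ C₀ := by positivity
  refine ⟨1 + C₀, by positivity, fun Ω 𝒯H 𝒯h hH hh href r T hT v hv => ?_⟩
  have hvol := DiscreteKorn.Triangulation.volume_real_hull_pos 𝒯H hT
  have hen := DiscreteKorn.Triangulation.brokenEnergy_nonneg 𝒯h T v
  obtain ⟨V, hVm, ⟨M, hM⟩, hV⟩ := DiscreteKorn.Triangulation.exists_measurable_selection
    (𝒯h.trianglesIn T) (w := DiscreteKorn.piece v) (DiscreteKorn.continuous_piece v)
  have hvV : v =ᵐ[volume.restrict (DiscreteKorn.hull T)] V :=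
    DiscreteKorn.Triangulation.ae_eq_of_selection href hT
      (fun t ht => let ⟨p, _, hp⟩ := hv t ht; ⟨p, hp⟩) hV
  obtain ⟨m, hm, hmc, hmi⟩ := DiscreteKorn.Triangulation.exists_rigidMotion_lintegral_le hH href
    hT v hVm hM fun x hx => hV x (DiscreteKorn.Triangulation.exists_mem_trianglesIn href hT hx)
  have hmL : MemLp m 2 (volume.restrict (DiscreteKorn.hull T)) := by
    have hfin : IsFiniteMeasure (volume.restrict (DiscreteKorn.hull T)) := ⟨by
      rw [Measure.restrict_apply_univ]
      exact (DiscreteKorn.isCompact_hull T).measure_lt_top⟩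
    obtain ⟨c, hc⟩ := (DiscreteKorn.isCompact_hull T).exists_bound_of_continuousOn hmc.continuousOn
    exact MemLp.of_bound hmc.aestronglyMeasurable c
      ((ae_restrict_iff' (DiscreteKorn.measurableSet_hull T)).2 (Filter.Eventually.of_forall hc))
  have hle : ‖v - MemLp.toLp m hmL‖ ^ 2 ≤
      C₀ * volume.real (DiscreteKorn.hull T) * DiscreteKorn.Triangulation.brokenEnergy 𝒯h T v := by
    refine DiscreteKorn.norm_sq_le_of_lintegral_le _ (by positivity) ?_
    have hae : ∀ᵐ x ∂(volume.restrict (DiscreteKorn.hull T)),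
        ‖(v - MemLp.toLp m hmL : DiscreteKorn.L2 _) x‖ₑ ^ 2 = ‖V x - m x‖ₑ ^ 2 := by
      filter_upwards [hvV, Lp.coeFn_sub v (MemLp.toLp m hmL), hmL.coeFn_toLp] with x h1 h2 h3
      rw [h2, Pi.sub_apply, h1, h3]
    rw [lintegral_congr_ae hae]
    refine hmi.trans ?_
    refine (mul_le_mul_right (DiscreteKorn.Triangulation.totalStrain_sq_le hh href hT v) _).trans ?_
    rw [← ENNReal.ofReal_mul (by positivity)]
    exact ENNReal.ofReal_le_ofReal (le_of_eq (by rw [hC₀]; ring))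
  have hsize : (DiscreteKorn.size T)⁻¹ ^ 2 = (volume.real (DiscreteKorn.hull T))⁻¹ := by
    rw [DiscreteKorn.size, inv_pow, Real.sq_sqrt hvol.le]
  rw [hsize]
  change _ ≤ (1 + C₀) * DiscreteKorn.Triangulation.brokenEnergy 𝒯h T v
  rw [inv_mul_le_iff₀ hvol]
  calc _ ≤ ‖v - MemLp.toLp m hmL‖ ^ 2 := by
        gcongr; exact DiscreteKorn.norm_sub_rigidProj_le v hm hmL
    _ ≤ C₀ * volume.real (DiscreteKorn.hull T) *
          DiscreteKorn.Triangulation.brokenEnergy 𝒯h T v := hle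
    _ ≤ _ := by nlinarith [mul_nonneg hvol.le hen]
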